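/- Let $p,q\ge 0$ be integers, $M>0$, $\Theta_1=[-M,M]\times[-M,M]\times[0,\pi]$, and let $$y(t)=\sum_{j=1}^{p}\{A_j^0\cos(\alpha_j^0t)+B_j^0\sin(\alpha_j^0t)\}+\sum_{k=1}^{q}\{C_k^0\cos(\beta_k^0t^2)+D_k^0\sin(\beta_k^0t^2)\}+X(t),\qquad t=1,2,\dots$$ Assume: 1. $X(t)=\sum_{j\in\mathbb Z}a(j)e(t-j)$ with $\sum_j|a(j)|<\infty$ and $(e(t))_{t\in\mathbb Z}$ i.i.d. with mean $0$ and finite variance $\sigma^2$. 2. All $(A_j^0,B_j^0,\alpha_j^0)$ and $(C_k^0,D_k^0,\beta_k^0)$ are interior points of $\Theta_1$; the $\alpha_j^0$ are distinct and the $\beta_k^0$ are distinct. 3. $(A_1^0)^2+(B_1^0)^2>\dots>(A_p^0)^2+(B_p^0)^2>0$ and $(C_1^0)^2+(D_1^0)^2>\dots>(C_q^0)^2+(D_q^0)^2>0$. 4. The frequency rates are not exceptional: $\beta_k^0/\pi$ is irrational for every $k$, and $(\beta_k^0-\beta_l^0)/\pi$ and $(\beta_k^0+\beta_l^0)/\pi$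 are irrational for all $k\ne l$. From $y(1),\dots,y(n)$, fit $P$ sinusoids and then $Q$ chirp terms by sequential least squares. Put $y_0=y$. For $j=1,\dots,P$ let $(\tilde A_j,\tilde B_j,\tilde\alpha_j)$ be a minimiser over $\Theta_1$ of $\sum_{t=1}^n\big(y_{j-1}(t)-A\cos(\alpha t)-B\sin(\alpha t)\big)^2$, and put $y_j(t)=y_{j-1}(t)-\tilde A_j\cos(\tilde\alpha_jt)-\tilde B_j\sin(\tilde\alpha_jt)$. For $k=1,\dots,Q$ let $(\tilde C_k,\tilde D_k,\tilde\beta_k)$ be a minimiser over $\Theta_1$ of $\sum_{t=1}^n\big(y_{P+k-1}(t)-C\cos(\beta t^2)-D\sin(\beta t^2)\big)^2$, and put $y_{P+k}(t)=y_{P+k-1}(t)-\tilde C_k\cos(\tilde\beta_kt^2)-\tilde D_k\sin(\tilde\beta_kt^2)$. All estimates depend on $n$. Then: (a) If $P>p$, then almost surely $\tilde A_{p+1}\to0$ as $n\to\infty$ and, for every $r>0$, $\tilde B_{p+1}\to0$ as $n\to\infty$ through those $n$ for which $\tilde\alpha_{p+1}\in[r/n,\ \pi-r/n]$. (b) If $P\ge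 p$ and $Q>q$, then almost surely $\tilde C_{q+1}\to0$ as $n\to\infty$ and, for every $r>0$, $\tilde D_{q+1}\to0$ as $n\to\infty$ through those $n$ for which $\tilde\beta_{q+1}\in[r/n^2,\ \pi-r/n^2]$. (At frequencies $0$ and $\pi$ the sine term vanishes identically at integer times, so that its coefficient is not identifiable; the restriction in the claims on $\tilde B_{p+1}$ and $\tilde D_{q+1}$ leaves out only sample sizes at which the fitted frequency cannot be told from such an endpoint.) -/

import Mathlib

open MeasureTheory ProbabilityTheory Filter Topology

noncomputable section

namespace ChirpLike

/-- Parameters of one component: (amplitude of the cosine, amplitude of the sine,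
frequency or frequency rate). -/
abbrev Component : Type := ℝ × ℝ × ℝ

/-- The coefficient of the cosine (`A` for a sinusoid, `C` for a chirp term). -/
def cosAmp (θ : Component) : ℝ := θ.1

/-- The coefficient of the sine (`B` for a sinusoid, `D` for a chirp term). -/
def sinAmp (θ : Component) : ℝ := θ.2.1

/-- The frequency of a sinusoid, or the frequency rate of a chirp term. -/
def freq (θ : Component) : ℝ := θ.2.2

/-- The parameter space `[-M, M] × [-M, M] × [0, π]` of one component. -/
def paramSpace (M : ℝ) : Set Component :=
  Set.Icc (-M) M ×ˢ Set.Icc (-M) M ×ˢ Set.Icc 0 Real.pi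

/-- `A cos (α t) + B sin (α t)`. -/
def sinusoid (θ : Component) (t : ℕ) : ℝ :=
  cosAmp θ * Real.cos (freq θ * t) + sinAmp θ * Real.sin (freq θ * t)

/-- `C cos (β t²) + D sin (β t²)`. -/
def chirp (θ : Component) (t : ℕ) : ℝ :=
  cosAmp θ * Real.cos (freq θ * (t : ℝ) ^ 2) + sinAmp θ * Real.sin (freq θ * (t : ℝ) ^ 2)

/-- The noiseless chirp-like signal with sinusoids `θ` and chirp terms `ξ`. -/
def signal {p q : ℕ} (θ : Fin p → Component) (ξ : Fin q → Component) (t : ℕ) : ℝ :=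
  ∑ j, sinusoid (θ j) t + ∑ k, chirp (ξ k) t

/-- The error sum of squares, over `t = 1, …, n`, of fitting one component `g θ` to the data `z`. -/
def errorSS (n : ℕ) (z : ℕ → ℝ) (g : Component → ℕ → ℝ) (θ : Component) : ℝ :=
  ∑ t ∈ Finset.Icc 1 n, (z t - g θ t) ^ 2

/-- `θ` is a least squares estimate over the parameter space for one component of shape `g`,
from the data `z 1, …, z n`. -/
def IsLSE (M : ℝ) (n : ℕ) (z : ℕ → ℝ) (g : Component → ℕ → ℝ) (θ : Component) : Prop :=
  θ ∈ paramSpace M ∧ ∀ θ' ∈ paramSpace M, errorSS n z g θ ≤ errorSS n z g θ'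

/-- The data left after subtracting the first `j` fitted sinusoids. -/
def sinResidual (y : ℕ → ℝ) (s : ℕ → Component) (j : ℕ) (t : ℕ) : ℝ :=
  y t - ∑ i ∈ Finset.range j, sinusoid (s i) t

/-- The data left after subtracting all `P` fitted sinusoids and the first `k` fitted
chirp terms. -/
def chirpResidual (y : ℕ → ℝ) (P : ℕ) (s c : ℕ → Component) (k : ℕ) (t : ℕ) : ℝ :=
  sinResidual y s P t - ∑ i ∈ Finset.range k, chirp (c i) t

/-- `s 0, …, s (P-1)` and `c 0, …, c (Q-1)` are sequential least squares estimates of `P` sinusoids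
and `Q` chirp terms from the data `y 1, …, y n`: first the sinusoids, then the chirp terms are
fitted one after the other, each to what the components fitted before have left of the data.
The entries of `s` and `c` beyond `P` and `Q` play no role. -/
structure IsSequentialLSE (M : ℝ) (n : ℕ) (y : ℕ → ℝ) (P Q : ℕ) (s c : ℕ → Component) :
    Prop where
  sinusoid_step : ∀ j < P, IsLSE M n (sinResidual y s j) sinusoid (s j)
  chirp_step : ∀ k < Q, IsLSE M n (chirpResidual y P s c k) chirp (c k)

/-- `X` is the stationary linear process `X(t) = ∑ a(j) e(t - j)` with i.i.d. innovations `e` of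
mean zero and variance `σ²`, and absolutely summable coefficients `a`. -/
structure IsLinearProcess {Ω : Type*} [MeasurableSpace Ω] (μ : Measure Ω) (σ : ℝ)
    (a : ℤ → ℝ) (e X : ℤ → Ω → ℝ) : Prop where
  indep : iIndepFun e μ
  identDistrib : ∀ t, IdentDistrib (e t) (e 0) μ μ
  memLp : ∀ t, MemLp (e t) 2 μ
  mean_eq : ∀ t, ∫ ω, e t ω ∂μ = 0
  variance_eq : ∀ t, variance (e t) μ = σ ^ 2
  summable_coeff : Summable fun j => |a j|
  hasSum : ∀ t, ∀ᵐ ω ∂μ, HasSum (fun j : ℤ => a j * e (t - j) ω) (X t ω)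

end ChirpLike

end

/-! A surplus component is fitted to data that are asymptotically uncorrelated, uniformly over the
parameter space, with every candidate. Comparison with the zero candidate forces its empirical power
to zero (`tendsto_ip_self_of_uniformNull`). It remains to see that the residual is of this kind, and
what vanishing power says about the amplitudes.

Residual: no candidate can correlate with two true components at once, since that would make the
difference or the sum of their frequencies resonant (`HasResonances.exclusive`). Hence each fit
picks the strongest component left (`tendsto_ip_sub_of_isLSE`), with an error of vanishing power. By
Cauchy-Schwarz such an error is null against every shape, so the induction over the fits needs no
rates (`HasResonances.tendsto_sequential`). Chirps of irrational rate are null against sinusoids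
(`uniformNull_chirp`).

Noise: two van der Corput differencings remove a quadratic phase and leave products of the noise at
four times. Finite variance controls their second moments when the times are distinct. The supremum
over all phases then has expectation O(N^(7/8)); summing over N = m^16 and over the coefficients
gives the almost sure statement (`ae_eventually_norm_sum_le`).

Amplitudes: if an amplitude stays large while the power vanishes, first differences of the phase
(second differences for chirps) force n^d |sin freq| to zero, with d = 1 or 2
(`EndpointDegenerate`). The sine term is then negligible at all times, so a large cosine amplitude
would show in the power; and the frequency is closer to 0 or π than any r/n^d
(`EndpointDegenerate.tendsto_amp`). -/

noncomputable section

namespace ChirpLike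

/-! ### Empirical inner products and null arrays -/

/-- The empirical inner product of two sequences over `t = 1, …, n`. -/
def ip (n : ℕ) (f g : ℕ → ℝ) : ℝ := (∑ t ∈ Finset.Icc 1 n, f t * g t) / n

lemma ip_comm (n : ℕ) (f g : ℕ → ℝ) : ip n f g = ip n g f := by
  simp only [ip, mul_comm]

lemma ip_add_left (n : ℕ) (f g h : ℕ → ℝ) : ip n (f + g) h = ip n f h + ip n g h := by
  simp only [ip, Pi.add_apply, add_mul, Finset.sum_add_distrib, add_div]

lemma ip_sub_left (n : ℕ) (f g h : ℕ → ℝ) : ip n (f - g) h = ip n f h - ip n g h := by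
  simp only [ip, Pi.sub_apply, sub_mul, Finset.sum_sub_distrib, sub_div]

lemma ip_sub_right (n : ℕ) (f g h : ℕ → ℝ) : ip n f (g - h) = ip n f g - ip n f h := by
  rw [ip_comm, ip_sub_left, ip_comm n g, ip_comm n h]

lemma ip_sum_left {ι : Type*} (n : ℕ) (J : Finset ι) (f : ι → ℕ → ℝ) (h : ℕ → ℝ) :
    ip n (∑ i ∈ J, f i) h = ∑ i ∈ J, ip n (f i) h := by
  classical
  induction J using Finset.induction_on with
  | empty => simp [ip]
  | insert i J hi ih => rw [Finset.sum_insert hi, Finset.sum_insert hi, ip_add_left, ih]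

lemma ip_self_nonneg (n : ℕ) (f : ℕ → ℝ) : 0 ≤ ip n f f :=
  div_nonneg (Finset.sum_nonneg fun t _ => mul_self_nonneg (f t)) n.cast_nonneg

lemma ip_sub_self (n : ℕ) (f g : ℕ → ℝ) :
    ip n (f - g) (f - g) = ip n f f - 2 * ip n f g + ip n g g := by
  rw [ip_sub_left, ip_sub_right, ip_sub_right, ip_comm n g f]; ring

lemma sq_ip_le (n : ℕ) (f g : ℕ → ℝ) : ip n f g ^ 2 ≤ ip n f f * ip n g g := by
  simp only [ip]
  rw [div_pow, div_mul_div_comm, ← sq (n : ℝ)]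
  refine div_le_div_of_nonneg_right ?_ (by positivity)
  have := Finset.sum_mul_sq_le_sq_mul_sq (Finset.Icc 1 n) f g
  simpa only [sq] using this

lemma ip_self_le {n : ℕ} {f : ℕ → ℝ} {K : ℝ} (hf : ∀ t, |f t| ≤ K) : ip n f f ≤ K ^ 2 := by
  have hb : ∑ t ∈ Finset.Icc 1 n, f t * f t ≤ n * K ^ 2 := by
    refine (Finset.sum_le_card_nsmul _ _ (K ^ 2) fun t _ => ?_).trans (by simp)
    rw [← sq, ← sq_abs]
    exact pow_le_pow_left₀ (abs_nonneg _) (hf t) 2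
  rcases n.eq_zero_or_pos with rfl | hn
  · simpa [ip] using sq_nonneg K
  · rw [ip, div_le_iff₀ (by positivity), mul_comm]; exact hb

/-- One component with phase `freq θ * ψ t`; `ψ t = t` is a sinusoid, `ψ t = t ^ 2` a chirp. -/
def atom (ψ : ℕ → ℝ) (θ : Component) (t : ℕ) : ℝ :=
  cosAmp θ * Real.cos (freq θ * ψ t) + sinAmp θ * Real.sin (freq θ * ψ t)

lemma sinusoid_eq_atom : sinusoid = atom fun t => (t : ℝ) := rfl

lemma chirp_eq_atom : chirp = atom fun t => (t : ℝ) ^ 2 := rfl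

lemma abs_cosAmp_le {M : ℝ} {θ : Component} (h : θ ∈ paramSpace M) : |cosAmp θ| ≤ M :=
  abs_le.2 h.1

lemma abs_sinAmp_le {M : ℝ} {θ : Component} (h : θ ∈ paramSpace M) : |sinAmp θ| ≤ M :=
  abs_le.2 h.2.1

lemma abs_atom_le {M : ℝ} {θ : Component} (h : θ ∈ paramSpace M) (ψ : ℕ → ℝ) (t : ℕ) :
    |atom ψ θ t| ≤ 2 * M := by
  have h1 := abs_cosAmp_le h
  have h2 := abs_sinAmp_le h
  have h3 := Real.abs_cos_le_one (freq θ * ψ t)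
  have h4 := Real.abs_sin_le_one (freq θ * ψ t)
  refine (abs_add_le _ _).trans ?_
  rw [abs_mul, abs_mul]
  nlinarith [abs_nonneg (cosAmp θ), abs_nonneg (sinAmp θ)]

lemma zero_mem_paramSpace {M : ℝ} (hM : 0 ≤ M) : ((0, 0, 0) : Component) ∈ paramSpace M := by
  simp [paramSpace, hM, Real.pi_pos.le]

lemma atom_zero (ψ : ℕ → ℝ) : atom ψ (0, 0, 0) = 0 := by
  funext t; simp [atom, cosAmp, sinAmp]

/-- Expanding the squares cancels the power of the data; minimality is used only in this form. -/
lemma IsLSE.ip_le {M : ℝ} {n : ℕ} {z ψ : ℕ → ℝ} {θ θ' : Component}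
    (h : IsLSE M n z (atom ψ) θ) (h' : θ' ∈ paramSpace M) :
    ip n (atom ψ θ) (atom ψ θ) - 2 * ip n z (atom ψ θ) ≤
      ip n (atom ψ θ') (atom ψ θ') - 2 * ip n z (atom ψ θ') := by
  have key : ∀ φ, errorSS n z (atom ψ) φ / n =
      ip n z z - 2 * ip n z (atom ψ φ) + ip n (atom ψ φ) (atom ψ φ) := by
    intro φ
    rw [← ip_sub_self, ip, errorSS]
    simp only [Pi.sub_apply, sq]
  have := div_le_div_of_nonneg_right (h.2 θ' h') (n.cast_nonneg : (0 : ℝ) ≤ n)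
  rw [key, key] at this
  linarith

/-- The array `w` is asymptotically uncorrelated with all components of shape `ψ`, uniformly. -/
def UniformNull (ψ : ℕ → ℝ) (M : ℝ) (w : ℕ → ℕ → ℝ) : Prop :=
  ∀ ε > 0, ∀ᶠ n in atTop, ∀ θ ∈ paramSpace M, |ip n (w n) (atom ψ θ)| ≤ ε

lemma UniformNull.add {ψ : ℕ → ℝ} {M : ℝ} {v w : ℕ → ℕ → ℝ} (hv : UniformNull ψ M v)
    (hw : UniformNull ψ M w) : UniformNull ψ M (v + w) := by
  intro ε hε
  filter_upwards [hv (ε / 2) (half_pos hε), hw (ε / 2) (half_pos hε)] with n h1 h2 θ hθ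
  rw [Pi.add_apply, ip_add_left]
  exact (abs_add_le _ _).trans (by linarith [h1 θ hθ, h2 θ hθ])

lemma UniformNull.neg {ψ : ℕ → ℝ} {M : ℝ} {v : ℕ → ℕ → ℝ} (hv : UniformNull ψ M v) :
    UniformNull ψ M (-v) := by
  intro ε hε
  filter_upwards [hv ε hε] with n h1 θ hθ
  have : ip n ((-v) n) (atom ψ θ) = - ip n (v n) (atom ψ θ) := by
    simp [ip, neg_div]
  rw [this, abs_neg]
  exact h1 θ hθ

lemma UniformNull.sub {ψ : ℕ → ℝ} {M : ℝ} {v w : ℕ → ℕ → ℝ} (hv : UniformNull ψ M v)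
    (hw : UniformNull ψ M w) : UniformNull ψ M (v - w) := by
  rw [sub_eq_add_neg]; exact hv.add hw.neg

lemma UniformNull.zero (ψ : ℕ → ℝ) (M : ℝ) : UniformNull ψ M 0 := by
  intro ε hε
  exact Eventually.of_forall fun n θ _ => by simpa [ip] using hε.le

lemma UniformNull.sum {ι : Type*} {ψ : ℕ → ℝ} {M : ℝ} (J : Finset ι) {v : ι → ℕ → ℕ → ℝ}
    (hv : ∀ i ∈ J, UniformNull ψ M (v i)) : UniformNull ψ M (∑ i ∈ J, v i) := by
  classical
  induction J using Finset.induction_on with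
  | empty => simpa using UniformNull.zero ψ M
  | insert i J hi ih =>
    rw [Finset.sum_insert hi]
    exact (hv i (by simp)).add (ih fun j hj => hv j (by simp [hj]))

/-- Cauchy-Schwarz against uniformly bounded components. As ψ is arbitrary, errors of fitted
sinusoids are null for chirps too. -/
lemma UniformNull.of_ip_self {ψ : ℕ → ℝ} {M : ℝ} {v : ℕ → ℕ → ℝ}
    (hv : Tendsto (fun n => ip n (v n) (v n)) atTop (𝓝 0)) : UniformNull ψ M v := by
  intro ε hε
  have h1 : Tendsto (fun n => ip n (v n) (v n) * (2 * M) ^ 2) atTop (𝓝 0) := by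
    simpa using hv.mul_const ((2 * M) ^ 2)
  filter_upwards [h1.eventually (gt_mem_nhds (pow_pos hε 2))] with n hn θ hθ
  refine abs_le_of_sq_le_sq ?_ hε.le
  refine (sq_ip_le _ _ _).trans (le_trans ?_ hn.le)
  exact mul_le_mul_of_nonneg_left (ip_self_le fun t => abs_atom_le hθ ψ t) (ip_self_nonneg _ _)

/-! ### What a single least squares fit selects -/

lemma abs_sum_sub_le {ι : Type*} [DecidableEq ι] {J : Finset ι} {i : ι} (hi : i ∈ J) {f : ι → ℝ}
    {δ : ℝ} (hδ : 0 ≤ δ) (hf : ∀ j ∈ J, j ≠ i → |f j| ≤ δ) : |∑ j ∈ J, f j - f i| ≤ J.card * δ := by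
  rw [← Finset.sum_erase_eq_sub hi]
  refine (Finset.abs_sum_le_sum_abs _ _).trans ?_
  refine (Finset.sum_le_card_nsmul _ _ δ fun j hj => ?_).trans ?_
  · exact hf j (Finset.mem_of_mem_erase hj) (Finset.ne_of_mem_erase hj)
  · rw [nsmul_eq_mul]
    gcongr
    exact Finset.erase_subset _ _

/-- A least squares fit to a null array has vanishing power. -/
lemma tendsto_ip_self_of_uniformNull {ψ : ℕ → ℝ} {M : ℝ} (hM : 0 ≤ M) {w : ℕ → ℕ → ℝ}
    (hw : UniformNull ψ M w) {est : ℕ → Component} (hest : ∀ n, IsLSE M n (w n) (atom ψ) (est n)) :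
    Tendsto (fun n => ip n (atom ψ (est n)) (atom ψ (est n))) atTop (𝓝 0) := by
  refine (tendsto_order.2 ⟨fun a ha => Eventually.of_forall fun n =>
    ha.trans_le (ip_self_nonneg _ _), fun a ha => ?_⟩)
  filter_upwards [hw (a / 3) (by linarith)] with n hn
  have h1 := (hest n).ip_le (zero_mem_paramSpace hM)
  have h2 := abs_le.1 (hn _ (hest n).1)
  have h3 : ∀ f, ip n f (atom ψ (0, 0, 0)) = 0 := fun f => by simp [atom_zero, ip]
  rw [h3, h3] at h1
  linarith

/-- A least squares fit to a sum of asymptotically exclusive components picks out the one of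
largest power. -/
lemma tendsto_ip_sub_of_isLSE {ι : Type*} [DecidableEq ι] {J : Finset ι} {ψ : ℕ → ℝ} {M : ℝ}
    {ϑ : ι → Component} (hϑ : ∀ i ∈ J, ϑ i ∈ paramSpace M) {L : ι → ℝ}
    (hL : ∀ i ∈ J, Tendsto (fun n => ip n (atom ψ (ϑ i)) (atom ψ (ϑ i))) atTop (𝓝 (L i)))
    {i₀ : ι} (hi₀ : i₀ ∈ J) (hpos : 0 < L i₀) (hlt : ∀ i ∈ J, i ≠ i₀ → L i < L i₀)
    (excl : ∀ ε > 0, ∀ᶠ n in atTop, ∀ θ ∈ paramSpace M, ∀ i ∈ J, ∀ j ∈ J, i ≠ j →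
      |ip n (atom ψ (ϑ i)) (atom ψ θ)| < ε ∨ |ip n (atom ψ (ϑ j)) (atom ψ θ)| < ε)
    {w : ℕ → ℕ → ℝ} (hw : UniformNull ψ M w) {est : ℕ → Component}
    (hest : ∀ n, IsLSE M n (∑ i ∈ J, atom ψ (ϑ i) + w n) (atom ψ) (est n)) :
    Tendsto (fun n => ip n (atom ψ (est n) - atom ψ (ϑ i₀)) (atom ψ (est n) - atom ψ (ϑ i₀)))
      atTop (𝓝 0) := by
  refine (tendsto_order.2 ⟨fun a ha => Eventually.of_forall fun n =>
    ha.trans_le (ip_self_nonneg _ _), fun a ha => ?_⟩)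
  obtain ⟨m, hm⟩ : ∃ m : ℝ, m = J.card := ⟨_, rfl⟩
  have hm0 : 0 ≤ m := hm ▸ J.card.cast_nonneg
  -- The factor 4m + 6 covers the errors collected in both cases below; 2δ < L i₀ makes component i₀
  -- correlate with itself by more than δ.
  obtain ⟨δ, hδa, hδL, hδi, hδ⟩ : ∃ δ : ℝ, (4 * m + 6) * δ < a ∧ 2 * δ < L i₀ ∧
      (∀ i ∈ J, i ≠ i₀ → (4 * m + 6) * δ < L i₀ - L i) ∧ 0 < δ := by
    have hlim : ∀ c : ℝ, Tendsto (fun δ : ℝ => c * δ) (𝓝[>] 0) (𝓝 0) := fun c => by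
      have : Tendsto (fun δ : ℝ => c * δ) (𝓝 0) (𝓝 (c * 0)) := tendsto_id.const_mul c
      rw [mul_zero] at this
      exact this.mono_left nhdsWithin_le_nhds
    have e1 := (hlim (4 * m + 6)).eventually (gt_mem_nhds ha)
    have e2 := (hlim 2).eventually (gt_mem_nhds hpos)
    have e3 : ∀ᶠ δ : ℝ in 𝓝[>] 0, ∀ i ∈ J, i ≠ i₀ → (4 * m + 6) * δ < L i₀ - L i := by
      refine (Filter.eventually_all_finset J).2 fun i hi => ?_
      by_cases h : i = i₀
      · simp [h]
      · filter_upwards [(hlim (4 * m + 6)).eventually (gt_mem_nhds (sub_pos.2 (hlt i hi h)))]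
          with δ hδ _ using hδ
    exact (e1.and (e2.and (e3.and self_mem_nhdsWithin))).exists
  have hN : ∀ᶠ n in atTop, ∀ i ∈ J, |ip n (atom ψ (ϑ i)) (atom ψ (ϑ i)) - L i| < δ := by
    refine (Filter.eventually_all_finset J).2 fun i hi => ?_
    simpa [Real.dist_eq] using (hL i hi).eventually (Metric.ball_mem_nhds (L i) hδ)
  filter_upwards [excl δ hδ, hw δ hδ, hN] with n hex hwn hNn
  set g := atom ψ (est n)
  have hlse := (hest n).ip_le (hϑ i₀ hi₀)
  rw [ip_add_left, ip_add_left, ip_sum_left, ip_sum_left] at hlse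
  have hW := abs_le.1 (hwn _ (hest n).1)
  have hW0 := abs_le.1 (hwn _ (hϑ i₀ hi₀))
  have hN0 := abs_lt.1 (hNn i₀ hi₀)
  -- Exclusivity at the candidate `ϑ i₀`: it correlates with itself, so the other components are
  -- nearly orthogonal to it.
  have horth := abs_le.1 (abs_sum_sub_le hi₀ (f := fun i => ip n (atom ψ (ϑ i)) (atom ψ (ϑ i₀)))
    hδ.le fun j hj hji => by
      rcases hex _ (hϑ i₀ hi₀) j hj i₀ hi₀ hji with h | h
      · exact h.le
      · have := (abs_lt.1 h).2
        linarith)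
  rw [← hm] at horth
  rw [ip_sub_self]
  by_cases hcase : ∀ j ∈ J, j ≠ i₀ → |ip n (atom ψ (ϑ j)) g| ≤ δ
  -- Here the sum may be replaced by `ϑ i₀` in both objectives, and minimality becomes a bound on
  -- the squared distance.
  · have hS := abs_le.1 (abs_sum_sub_le hi₀ (f := fun i => ip n (atom ψ (ϑ i)) g) hδ.le hcase)
    rw [← hm] at hS
    rw [ip_comm n g (atom ψ (ϑ i₀))]
    linarith
  -- A fit that correlates with some i ≠ i₀ correlates with no other component. Its objective is
  -- then at least about -L i, whereas `ϑ i₀` reaches about -L i₀.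
  · exfalso
    push Not at hcase
    obtain ⟨i, hi, hi0, hbig⟩ := hcase
    have hS := abs_le.1 (abs_sum_sub_le hi (f := fun i => ip n (atom ψ (ϑ i)) g) hδ.le
      fun j hj hji => by
        rcases hex _ (hest n).1 j hj i hi hji with h | h
        · exact h.le
        · exact absurd h (not_lt.2 hbig.le))
    rw [← hm] at hS
    have h1 := ip_self_nonneg n (g - atom ψ (ϑ i))
    rw [ip_sub_self, ip_comm n g (atom ψ (ϑ i))] at h1
    have h2 := abs_lt.1 (hNn i hi)
    have h3 := hδi i hi hi0
    linarith

/-! ### Unit exponentials and van der Corput differencing -/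

/-- `exp (i x)`. -/
def cis (x : ℝ) : ℂ := Complex.exp (x * Complex.I)

lemma norm_cis (x : ℝ) : ‖cis x‖ = 1 := Complex.norm_exp_ofReal_mul_I x

lemma cis_add (x y : ℝ) : cis (x + y) = cis x * cis y := by
  simp [cis, add_mul, Complex.exp_add]

lemma cis_zero : cis 0 = 1 := by simp [cis]

lemma cis_re (x : ℝ) : (cis x).re = Real.cos x := Complex.exp_ofReal_mul_I_re x

lemma cis_im (x : ℝ) : (cis x).im = Real.sin x := Complex.exp_ofReal_mul_I_im x

lemma conj_cis (x : ℝ) : (starRingEnd ℂ) (cis x) = cis (-x) := by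
  apply Complex.ext <;> simp [cis_re, cis_im]

lemma cis_natCast_mul (k : ℕ) (x : ℝ) : cis (k * x) = cis x ^ k := by
  rw [cis, cis, ← Complex.exp_nat_mul]; push_cast; ring_nf

lemma cis_mul_natCast (k : ℕ) (x : ℝ) : cis (x * k) = cis x ^ k := by
  rw [mul_comm, cis_natCast_mul]

lemma norm_cis_neg_sub_one (x : ℝ) : ‖cis (-x) - 1‖ = ‖cis x - 1‖ := by
  rw [← Complex.norm_conj (cis x - 1), map_sub, conj_cis, map_one]

lemma norm_cis_add_sub_one_le (x y : ℝ) : ‖cis (x + y) - 1‖ ≤ ‖cis x - 1‖ + ‖cis y - 1‖ := by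
  have : cis (x + y) - 1 = cis y * (cis x - 1) + (cis y - 1) := by rw [cis_add]; ring
  rw [this]
  refine (norm_add_le _ _).trans ?_
  rw [norm_mul, norm_cis, one_mul]

lemma norm_cis_natCast_mul_sub_one_le (k : ℕ) (x : ℝ) : ‖cis (k * x) - 1‖ ≤ k * ‖cis x - 1‖ := by
  induction k with
  | zero => simp [cis_zero]
  | succ k ih =>
    push_cast
    rw [add_mul, one_mul, add_mul, one_mul]
    exact (norm_cis_add_sub_one_le _ _).trans (by linarith)

lemma norm_sum_cis_neg {ι : Type*} (T : Finset ι) (x : ι → ℝ) :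
    ‖∑ t ∈ T, cis (-x t)‖ = ‖∑ t ∈ T, cis (x t)‖ := by
  rw [← Complex.norm_conj (∑ t ∈ T, cis (x t)), map_sum]
  simp only [conj_cis]

lemma norm_sum_cis_le {ι : Type*} (T : Finset ι) (x : ι → ℝ) : ‖∑ t ∈ T, cis (x t)‖ ≤ T.card := by
  refine (norm_sum_le _ _).trans ?_
  simp [norm_cis]

lemma sum_Icc_one_eq {E : Type*} [AddCommMonoid E] (n : ℕ) (f : ℕ → E) :
    ∑ t ∈ Finset.Icc 1 n, f t = ∑ t ∈ Finset.range n, f (t + 1) := by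
  rw [Finset.range_eq_Ico, Finset.sum_Ico_add' f 0 n 1]
  rfl

/-- The pairs t < s are regrouped by their lag s - t, written h + 1 so that h starts at zero. -/
lemma sum_lt_eq_sum_lag {E : Type*} [AddCommMonoid E] (F : ℕ → ℕ → E) (n : ℕ) :
    ∑ s ∈ Finset.range n, ∑ t ∈ Finset.range s, F s t =
      ∑ h ∈ Finset.range n, ∑ t ∈ Finset.range (n - (h + 1)), F (t + (h + 1)) t := by
  induction n with
  | zero => simp
  | succ n ih =>
    have h1 : ∀ h ∈ Finset.range n,
        ∑ t ∈ Finset.range (n + 1 - (h + 1)), F (t + (h + 1)) t =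
          ∑ t ∈ Finset.range (n - (h + 1)), F (t + (h + 1)) t + F n (n - 1 - h) := by
      intro h hh
      have hh := Finset.mem_range.1 hh
      have e : n + 1 - (h + 1) = (n - (h + 1)) + 1 := by omega
      rw [e, Finset.sum_range_succ]
      congr 2 <;> omega
    rw [Finset.sum_range_succ, ih, Finset.sum_range_succ _ n, Finset.sum_congr rfl h1,
      Finset.sum_add_distrib, Finset.sum_range_reflect (fun t => F n t)]
    simp

/-- Van der Corput's expansion of the square of a sum into correlations. -/
lemma sq_norm_sum_le (f : ℕ → ℂ) (n : ℕ) :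
    ‖∑ t ∈ Finset.range n, f t‖ ^ 2 ≤ ∑ t ∈ Finset.range n, ‖f t‖ ^ 2 +
      2 * ∑ h ∈ Finset.range n,
        ‖∑ t ∈ Finset.range (n - (h + 1)), f (t + (h + 1)) * (starRingEnd ℂ) (f t)‖ := by
  have key : ‖∑ t ∈ Finset.range n, f t‖ ^ 2 = ∑ t ∈ Finset.range n, ‖f t‖ ^ 2 +
      2 * (∑ s ∈ Finset.range n, ∑ t ∈ Finset.range s, f s * (starRingEnd ℂ) (f t)).re := by
    induction n with
    | zero => simp
    | succ n ih =>
      rw [Finset.sum_range_succ, Finset.sum_range_succ, Finset.sum_range_succ, Complex.add_re,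
        ← Finset.mul_sum, ← map_sum]
      rw [add_comm (∑ t ∈ Finset.range n, f t) (f n), ← Complex.normSq_eq_norm_sq,
        Complex.normSq_add, Complex.normSq_eq_norm_sq, Complex.normSq_eq_norm_sq, ih]
      ring
  rw [key, sum_lt_eq_sum_lag]
  gcongr
  refine (Complex.re_le_norm _).trans (norm_sum_le _ _)

/-! ### Exponential sums and resonances -/

lemma norm_sum_geom_mul_le (γ : ℝ) (n : ℕ) :
    ‖∑ t ∈ Finset.range n, cis (γ * t)‖ * ‖cis γ - 1‖ ≤ 2 := by
  simp only [cis_mul_natCast]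
  rw [← norm_mul, geom_sum_mul]
  refine (norm_sub_le _ _).trans ?_
  rw [norm_pow, norm_cis]; norm_num

/-- The correlation sums of a quadratic phase are geometric sums. -/
lemma norm_quadratic_lag (x : ℕ → ℝ) (α β : ℝ) (h L : ℕ) :
    ‖∑ t ∈ Finset.range L, (x (t + h) * cis (β * ((t + h : ℕ) : ℝ) ^ 2 + α * ((t + h : ℕ) : ℝ))) *
      (starRingEnd ℂ) (x t * cis (β * (t : ℝ) ^ 2 + α * t))‖ =
    ‖∑ t ∈ Finset.range L, ((x t * x (t + h) : ℝ) : ℂ) * cis (2 * h * β * t)‖ := by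
  have : ∀ t ∈ Finset.range L,
      (x (t + h) * cis (β * ((t + h : ℕ) : ℝ) ^ 2 + α * ((t + h : ℕ) : ℝ))) *
      (starRingEnd ℂ) (x t * cis (β * (t : ℝ) ^ 2 + α * t)) =
      cis (β * h ^ 2 + α * h) * (((x t * x (t + h) : ℝ) : ℂ) * cis (2 * h * β * t)) := by
    intro t _
    rw [map_mul, conj_cis, Complex.conj_ofReal]
    have e : β * ((t + h : ℕ) : ℝ) ^ 2 + α * ((t + h : ℕ) : ℝ) =
      (β * h ^ 2 + α * h) + 2 * h * β * t + (β * (t : ℝ) ^ 2 + α * t) := by push_cast; ring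
    rw [e, cis_add, cis_add]
    have e2 : cis (β * (t : ℝ) ^ 2 + α * t) * cis (-(β * (t : ℝ) ^ 2 + α * t)) = 1 := by
      rw [← cis_add, add_neg_cancel, cis_zero]
    push_cast
    linear_combination (x (t + h) * x t * cis (β * h ^ 2 + α * h) * cis (2 * h * β * t) : ℂ) * e2
  rw [Finset.sum_congr rfl this, ← Finset.mul_sum, norm_mul, norm_cis, one_mul]

/-- Pigeonhole over blocks of length L. -/
lemma exists_close_pair {A : Finset ℕ} {n L : ℕ} (hA : ∀ a ∈ A, a < n)
    (hcard : n / L + 1 < A.card) (hL : 0 < L) : ∃ a ∈ A, ∃ b ∈ A, a < b ∧ b < a + L := by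
  obtain ⟨a, ha, b, hb, hne, hab⟩ := Finset.exists_ne_map_eq_of_card_lt_of_maps_to
    (s := A) (t := Finset.range (n / L + 1)) (f := fun a => a / L) (by simpa using hcard)
    (fun a ha => by
      simpa [Nat.lt_succ_iff] using Nat.div_le_div_right (hA a ha).le)
  have h1 := Nat.div_add_mod a L
  have h2 := Nat.div_add_mod b L
  have h3 := Nat.mod_lt a hL
  have h4 := Nat.mod_lt b hL
  have hab : a / L = b / L := hab
  rw [hab] at h1
  rcases lt_or_gt_of_ne hne with h | h
  · exact ⟨a, ha, b, hb, h, by omega⟩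
  · exact ⟨b, hb, a, ha, h, by omega⟩

/-- If a quadratic exponential sum is not small, then its leading coefficient is close to a
multiple of `π` by a rational number of bounded denominator. -/
lemma exists_resonance_quadratic {ε : ℝ} (hε : 0 < ε) : ∃ H : ℕ, ∃ C : ℝ, ∀ᶠ n : ℕ in atTop,
    ∀ α β : ℝ, ε * n ≤ ‖∑ t ∈ Finset.range n, cis (β * (t : ℝ) ^ 2 + α * t)‖ →
      ∃ h : ℕ, 1 ≤ h ∧ h ≤ H ∧ ‖cis (h * (2 * β)) - 1‖ ≤ C / n := by
  obtain ⟨L, hL⟩ := exists_nat_gt (16 / ε ^ 2)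
  have hε2 : 0 < ε ^ 2 := by positivity
  have hL0 : (0 : ℝ) < L := lt_trans (by positivity) hL
  refine ⟨L, 16 / ε ^ 2, ?_⟩
  obtain ⟨N, hN⟩ := exists_nat_gt (16 / ε ^ 2)
  filter_upwards [eventually_ge_atTop (max N 1)] with n hn α β hbig
  have hn1 : (1 : ℝ) ≤ n := by exact_mod_cast (le_max_right _ _).trans hn
  have hnN : 16 / ε ^ 2 < n := hN.trans_le (by exact_mod_cast (le_max_left _ _).trans hn)
  have hn0 : (0 : ℝ) < n := by linarith
  set V : ℕ → ℝ := fun h =>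
    ‖∑ t ∈ Finset.range (n - (h + 1)), cis (2 * ((h + 1 : ℕ) : ℝ) * β * t)‖ with hV
  have hVn : ∀ h, V h ≤ n := fun h => by
    refine (norm_sum_cis_le _ _).trans ?_
    rw [Finset.card_range]
    exact_mod_cast Nat.sub_le _ _
  have hexp : ‖∑ t ∈ Finset.range n, cis (β * (t : ℝ) ^ 2 + α * t)‖ ^ 2 ≤
      n + 2 * ∑ h ∈ Finset.range n, V h := by
    have := sq_norm_sum_le (fun t => ((1 : ℝ) : ℂ) * cis (β * (t : ℝ) ^ 2 + α * t)) n
    have e : ∀ h ∈ Finset.range n, _ = _ :=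
      fun h _ => norm_quadratic_lag (fun _ => 1) α β (h + 1) (n - (h + 1))
    rw [Finset.sum_congr rfl e] at this
    simpa [norm_cis, hV] using this
  -- The lags with large correlation; by the expansion they form a positive proportion of all lags
  -- (`hcard`).
  set A := (Finset.range n).filter fun h => ε ^ 2 * n / 4 ≤ V h with hA
  have hsum : ∑ h ∈ Finset.range n, V h ≤ A.card * n + n * (ε ^ 2 * n / 4) := by
    rw [← Finset.sum_filter_add_sum_filter_not (Finset.range n) fun h => ε ^ 2 * n / 4 ≤ V h]
    refine add_le_add ?_ ?_
    · exact (Finset.sum_le_card_nsmul _ _ _ fun h _ => hVn h).trans (by rw [nsmul_eq_mul])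
    · refine (Finset.sum_le_card_nsmul _ _ (ε ^ 2 * n / 4) fun h hh => ?_).trans ?_
      · exact (not_le.1 (Finset.mem_filter.1 hh).2).le
      · rw [nsmul_eq_mul]
        gcongr
        exact_mod_cast (Finset.card_filter_le _ _).trans (by simp)
  have hcard : ε ^ 2 * n / 4 - 1 / 2 ≤ A.card := by
    have h1 : (ε * n) ^ 2 ≤ n + 2 * (A.card * n + n * (ε ^ 2 * n / 4)) :=
      (pow_le_pow_left₀ (by positivity) hbig 2).trans (hexp.trans (by linarith))
    have h2 : n * (ε ^ 2 * n) ≤ n * (1 + 2 * A.card + ε ^ 2 * n / 2) := by nlinarith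
    have := le_of_mul_le_mul_left h2 hn0
    linarith
  have hεn : 16 < ε ^ 2 * n := by
    rw [div_lt_iff₀ hε2] at hnN; linarith
  -- Single lags in A may grow with n. Two of them differ by less than L, and the difference is the
  -- denominator of bounded size.
  obtain ⟨a, ha, b, hb, hab, hbL⟩ : ∃ a ∈ A, ∃ b ∈ A, a < b ∧ b < a + L := by
    refine exists_close_pair (n := n) (fun a ha => Finset.mem_range.1 (Finset.mem_filter.1 ha).1)
      ?_ (by exact_mod_cast hL0)
    have h1 : ((n / L : ℕ) : ℝ) ≤ n / L := Nat.cast_div_le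
    have h2 : (n : ℝ) / L ≤ ε ^ 2 * n / 16 := by
      rw [div_le_div_iff₀ hL0 (by norm_num)]
      rw [div_lt_iff₀ hε2] at hL
      nlinarith
    have : ((n / L + 1 : ℕ) : ℝ) < A.card := by push_cast; linarith
    exact_mod_cast this
  -- A geometric sum of order n has ratio within O(1/n) of 1.
  have hclose : ∀ a ∈ A, ‖cis (((a + 1 : ℕ) : ℝ) * (2 * β)) - 1‖ ≤ 8 / (ε ^ 2 * n) := by
    intro a ha
    have h1 := (Finset.mem_filter.1 ha).2
    have h2 := norm_sum_geom_mul_le (2 * ((a + 1 : ℕ) : ℝ) * β) (n - (a + 1))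
    have h3 := mul_le_mul_of_nonneg_right h1 (norm_nonneg (cis (2 * ((a + 1 : ℕ) : ℝ) * β) - 1))
    have e : ((a + 1 : ℕ) : ℝ) * (2 * β) = 2 * ((a + 1 : ℕ) : ℝ) * β := by ring
    rw [e, le_div_iff₀ (by positivity)]
    have h4 := h3.trans h2
    linarith
  refine ⟨b - a, by omega, by omega, ?_⟩
  have e : ((b - a : ℕ) : ℝ) * (2 * β) =
      ((b + 1 : ℕ) : ℝ) * (2 * β) + -(((a + 1 : ℕ) : ℝ) * (2 * β)) := by
    push_cast [Nat.cast_sub hab.le]; ring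
  rw [e]
  refine (norm_cis_add_sub_one_le _ _).trans ?_
  rw [norm_cis_neg_sub_one]
  have := add_le_add (hclose b hb) (hclose a ha)
  refine this.trans (le_of_eq ?_)
  field_simp
  norm_num

/-- `γ` is not a multiple of `2π` by a fraction whose denominator is in `K`. -/
def Nonresonant (K : Submonoid ℕ) (γ : ℝ) : Prop := ∀ k ∈ K, cis (k * γ) ≠ 1

/-- If an exponential sum of phase `γ * ψ t` is not small, then `γ` is close to a resonance. -/
def HasResonances (ψ : ℕ → ℝ) (K : Submonoid ℕ) : Prop :=
  ∀ ε > 0, ∃ H : ℕ, ∃ C : ℝ, ∀ᶠ n : ℕ in atTop, ∀ γ : ℝ,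
    ε * n ≤ ‖∑ t ∈ Finset.Icc 1 n, cis (γ * ψ t)‖ →
      ∃ h ∈ K, h ≤ H ∧ ‖cis (h * γ) - 1‖ ≤ C / n

lemma hasResonances_linear : HasResonances (fun t => (t : ℝ)) ⊥ := by
  intro ε hε
  refine ⟨1, 2 / ε, ?_⟩
  filter_upwards [eventually_ge_atTop 1] with n hn γ hbig
  have hn0 : (0 : ℝ) < n := by exact_mod_cast hn
  refine ⟨1, Submonoid.mem_bot.2 rfl, le_rfl, ?_⟩
  have h1 := norm_sum_geom_mul_le γ n
  have e : ‖∑ t ∈ Finset.Icc 1 n, cis (γ * t)‖ = ‖∑ t ∈ Finset.range n, cis (γ * t)‖ := by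
    rw [sum_Icc_one_eq]
    simp only [Nat.cast_add, Nat.cast_one, mul_add, mul_one, cis_add]
    rw [← Finset.sum_mul, norm_mul, norm_cis, mul_one]
  rw [e] at hbig
  rw [Nat.cast_one, one_mul, div_div, le_div_iff₀ (by positivity)]
  have := mul_le_mul_of_nonneg_right hbig (norm_nonneg (cis γ - 1))
  linarith

lemma norm_sum_Icc_quadratic (x : ℕ → ℝ) (α β : ℝ) (n : ℕ) :
    ‖∑ t ∈ Finset.Icc 1 n, (x t : ℂ) * cis (β * (t : ℝ) ^ 2 + α * t)‖ =
      ‖∑ t ∈ Finset.range n, (x (t + 1) : ℂ) * cis (β * (t : ℝ) ^ 2 + (2 * β + α) * t)‖ := by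
  rw [sum_Icc_one_eq]
  have : ∀ t : ℕ, (x (t + 1) : ℂ) * cis (β * ((t + 1 : ℕ) : ℝ) ^ 2 + α * ((t + 1 : ℕ) : ℝ)) =
      cis (β + α) * ((x (t + 1) : ℂ) * cis (β * (t : ℝ) ^ 2 + (2 * β + α) * t)) := by
    intro t
    rw [mul_left_comm, ← cis_add]
    push_cast
    ring_nf
  simp only [this]
  rw [← Finset.mul_sum, norm_mul, norm_cis, one_mul]

lemma norm_sum_Icc_quadratic_one (α β : ℝ) (n : ℕ) :
    ‖∑ t ∈ Finset.Icc 1 n, cis (β * (t : ℝ) ^ 2 + α * t)‖ =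
      ‖∑ t ∈ Finset.range n, cis (β * (t : ℝ) ^ 2 + (2 * β + α) * t)‖ := by
  simpa using norm_sum_Icc_quadratic (fun _ => 1) α β n

/-- The quadratic bound resonates through 2γ, hence the denominators 2h. `nonZeroDivisors ℕ` is the
monoid of positive integers. -/
lemma hasResonances_square :
    HasResonances (fun t => (t : ℝ) ^ 2) (nonZeroDivisors ℕ) := by
  intro ε hε
  obtain ⟨H, C, hHC⟩ := exists_resonance_quadratic hε
  refine ⟨2 * H, C, ?_⟩
  filter_upwards [hHC] with n hn γ hbig
  have e := norm_sum_Icc_quadratic_one 0 γ n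
  simp only [zero_mul, add_zero] at e
  rw [e] at hbig
  obtain ⟨h, h1, h2, h3⟩ := hn _ _ hbig
  refine ⟨2 * h, mem_nonZeroDivisors_of_ne_zero (by omega), by omega, ?_⟩
  have e : ((2 * h : ℕ) : ℝ) * γ = h * (2 * γ) := by push_cast; ring
  rwa [e]

/-- Only finitely many denominators are at most H. -/
lemma Nonresonant.exists_le {K : Submonoid ℕ} {γ : ℝ} (hγ : Nonresonant K γ) (H : ℕ) :
    ∃ c > 0, ∀ k ∈ K, k ≤ H → c ≤ ‖cis (k * γ) - 1‖ := by
  have : ∀ᶠ c : ℝ in 𝓝[>] 0, ∀ k ∈ Finset.range (H + 1), k ∈ K → c ≤ ‖cis (k * γ) - 1‖ := by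
    refine (Filter.eventually_all_finset _).2 fun k _ => ?_
    by_cases hk : k ∈ K
    · have := norm_pos_iff.2 (sub_ne_zero.2 (hγ k hk))
      filter_upwards [nhdsWithin_le_nhds (eventually_le_nhds this)] with c hc _ using hc
    · simp [hk]
  obtain ⟨c, hc, hc0⟩ := (this.and self_mem_nhdsWithin).exists
  exact ⟨c, hc0, fun k hk hkH => hc k (by simpa [Nat.lt_succ_iff] using hkH) hk⟩

lemma eventually_div_lt (C : ℝ) {c : ℝ} (hc : 0 < c) : ∀ᶠ n : ℕ in atTop, C / n < c :=
  (tendsto_const_div_atTop_nhds_zero_nat C).eventually (gt_mem_nhds hc)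

lemma HasResonances.eventually_lt {ψ : ℕ → ℝ} {K : Submonoid ℕ} (h : HasResonances ψ K) {γ : ℝ}
    (hγ : Nonresonant K γ) {ε : ℝ} (hε : 0 < ε) :
    ∀ᶠ n : ℕ in atTop, ‖∑ t ∈ Finset.Icc 1 n, cis (γ * ψ t)‖ < ε * n := by
  obtain ⟨H, C, hHC⟩ := h ε hε
  obtain ⟨c, hc, hcK⟩ := hγ.exists_le H
  filter_upwards [hHC, eventually_div_lt C hc] with n h1 h2
  by_contra hcon
  obtain ⟨k, hk, hkH, h3⟩ := h1 γ (not_lt.1 hcon)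
  linarith [hcK k hk hkH]

/-- If kγ₁ and lγ₂ are both close to multiples of 2π, so is kl(γ₁ - γ₂). Since kl must again be an
admissible denominator, K is taken to be a submonoid. -/
lemma HasResonances.eventually_lt_or_lt {ψ : ℕ → ℝ} {K : Submonoid ℕ} (h : HasResonances ψ K)
    {γ : ℝ} (hγ : Nonresonant K γ) {ε : ℝ} (hε : 0 < ε) :
    ∀ᶠ n : ℕ in atTop, ∀ γ₁ γ₂ : ℝ, γ₁ - γ₂ = γ →
      ‖∑ t ∈ Finset.Icc 1 n, cis (γ₁ * ψ t)‖ < ε * n ∨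
      ‖∑ t ∈ Finset.Icc 1 n, cis (γ₂ * ψ t)‖ < ε * n := by
  obtain ⟨H, C, hHC⟩ := h ε hε
  obtain ⟨c, hc, hcK⟩ := hγ.exists_le (H * H)
  filter_upwards [hHC, eventually_div_lt (2 * H * C) hc] with n h1 h2 γ₁ γ₂ h12
  by_contra! hcon
  obtain ⟨k, hk, hkH, h3⟩ := h1 γ₁ hcon.1
  obtain ⟨l, hl, hlH, h4⟩ := h1 γ₂ hcon.2
  have h5 := hcK (k * l) (K.mul_mem hk hl) (Nat.mul_le_mul hkH hlH)
  have e : ((k * l : ℕ) : ℝ) * γ = l * (k * γ₁) + -(k * (l * γ₂)) := by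
    rw [← h12]; push_cast; ring
  rw [e] at h5
  have h6 := h5.trans (norm_cis_add_sub_one_le _ _)
  rw [norm_cis_neg_sub_one] at h6
  have h7 := norm_cis_natCast_mul_sub_one_le l (k * γ₁)
  have h8 := norm_cis_natCast_mul_sub_one_le k (l * γ₂)
  have hkH' : (k : ℝ) ≤ H := by exact_mod_cast hkH
  have hlH' : (l : ℝ) ≤ H := by exact_mod_cast hlH
  have h9 : (l : ℝ) * ‖cis (k * γ₁) - 1‖ ≤ H * (C / n) :=
    mul_le_mul hlH' h3 (norm_nonneg _) (Nat.cast_nonneg _)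
  have h10 : (k : ℝ) * ‖cis (l * γ₂) - 1‖ ≤ H * (C / n) :=
    mul_le_mul hkH' h4 (norm_nonneg _) (Nat.cast_nonneg _)
  have e2 : 2 * H * C / n = H * (C / n) + H * (C / n) := by ring
  linarith

/-! ### Correlations between components -/

lemma abs_sum_mul_le {M A B A' B' : ℝ} (hA : |A| ≤ M) (hB : |B| ≤ M) (hA' : |A'| ≤ M)
    (hB' : |B'| ≤ M) (T : Finset ℕ) (x y : ℕ → ℝ) :
    |∑ t ∈ T, (A * Real.cos (x t) + B * Real.sin (x t)) *
      (A' * Real.cos (y t) + B' * Real.sin (y t))| ≤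
    2 * M ^ 2 * (‖∑ t ∈ T, cis (x t + y t)‖ + ‖∑ t ∈ T, cis (x t - y t)‖) := by
  have hcoef : ∀ {a b c d : ℝ}, |a| ≤ M → |b| ≤ M → |c| ≤ M → |d| ≤ M →
      |(a * b + c * d) / 2| ≤ M ^ 2 := by
    intro a b c d ha hb hc hd
    have h1 : |a * b| ≤ M ^ 2 := by
      rw [abs_mul, sq]; exact mul_le_mul ha hb (abs_nonneg _) ((abs_nonneg _).trans ha)
    have h2 : |c * d| ≤ M ^ 2 := by
      rw [abs_mul, sq]; exact mul_le_mul hc hd (abs_nonneg _) ((abs_nonneg _).trans hc)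
    rw [abs_div, abs_two]
    linarith [abs_add_le (a * b) (c * d)]
  have hB1 : |-B| ≤ M := by rwa [abs_neg]
  have hB1' : |-B'| ≤ M := by rwa [abs_neg]
  have key : ∑ t ∈ T, (A * Real.cos (x t) + B * Real.sin (x t)) *
      (A' * Real.cos (y t) + B' * Real.sin (y t)) =
      (A * A' + (-B) * B') / 2 * (∑ t ∈ T, cis (x t + y t)).re +
      (A * B' + B * A') / 2 * (∑ t ∈ T, cis (x t + y t)).im +
      (A * A' + B * B') / 2 * (∑ t ∈ T, cis (x t - y t)).re +
      (A * (-B') + B * A') / 2 * (∑ t ∈ T, cis (x t - y t)).im := by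
    simp only [Complex.re_sum, Complex.im_sum, cis_re, cis_im, Finset.mul_sum,
      ← Finset.sum_add_distrib]
    refine Finset.sum_congr rfl fun t _ => ?_
    rw [Real.cos_add, Real.sin_add, Real.cos_sub, Real.sin_sub]
    ring
  have hmul : ∀ {a b c : ℝ}, |a| ≤ M ^ 2 → |b| ≤ c → |a * b| ≤ M ^ 2 * c := by
    intro a b c h1 h2
    rw [abs_mul]
    exact mul_le_mul h1 h2 (abs_nonneg _) (by positivity)
  rw [key]
  have h1 := hmul (hcoef hA hA' hB1 hB') (Complex.abs_re_le_norm (∑ t ∈ T, cis (x t + y t)))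
  have h2 := hmul (hcoef hA hB' hB hA') (Complex.abs_im_le_norm (∑ t ∈ T, cis (x t + y t)))
  have h3 := hmul (hcoef hA hA' hB hB') (Complex.abs_re_le_norm (∑ t ∈ T, cis (x t - y t)))
  have h4 := hmul (hcoef hA hB1' hB hA') (Complex.abs_im_le_norm (∑ t ∈ T, cis (x t - y t)))
  rw [abs_le] at *
  constructor <;> linarith

lemma abs_ip_atom_atom_le {M : ℝ} {θ ϑ : Component} (hϑ : ϑ ∈ paramSpace M)
    (hθ : θ ∈ paramSpace M) (φ ψ : ℕ → ℝ) (n : ℕ) :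
    |ip n (atom φ ϑ) (atom ψ θ)| ≤
    2 * M ^ 2 * (‖∑ t ∈ Finset.Icc 1 n, cis (freq ϑ * φ t + freq θ * ψ t)‖ +
      ‖∑ t ∈ Finset.Icc 1 n, cis (freq ϑ * φ t - freq θ * ψ t)‖) / n := by
  rw [ip, abs_div, abs_of_nonneg (n.cast_nonneg : (0 : ℝ) ≤ n)]
  refine div_le_div_of_nonneg_right ?_ n.cast_nonneg
  exact abs_sum_mul_le (abs_cosAmp_le hϑ) (abs_sinAmp_le hϑ) (abs_cosAmp_le hθ)
    (abs_sinAmp_le hθ) _ _ _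

/-- A sequence that is uniformly uncorrelated with exponentials is null. -/
lemma uniformNull_of_norm_sum_le {ψ : ℕ → ℝ} {M : ℝ} (hM : 0 < M) {x : ℕ → ℝ}
    (hx : ∀ ε > 0, ∀ᶠ n : ℕ in atTop, ∀ γ : ℝ,
      ‖∑ t ∈ Finset.Icc 1 n, (x t : ℂ) * cis (γ * ψ t)‖ ≤ ε * n) :
    UniformNull ψ M fun _ => x := by
  intro ε hε
  filter_upwards [hx (ε / (2 * M)) (by positivity), eventually_ge_atTop 1] with n hn hn1 θ hθ
  have hn0 : (0 : ℝ) < n := by exact_mod_cast hn1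
  set S := ∑ t ∈ Finset.Icc 1 n, (x t : ℂ) * cis (freq θ * ψ t) with hS
  have key : ∑ t ∈ Finset.Icc 1 n, x t * atom ψ θ t = cosAmp θ * S.re + sinAmp θ * S.im := by
    simp only [hS, Complex.re_sum, Complex.im_sum, Complex.re_ofReal_mul, Complex.im_ofReal_mul,
      cis_re, cis_im, Finset.mul_sum, ← Finset.sum_add_distrib]
    refine Finset.sum_congr rfl fun t _ => ?_
    rw [atom]; ring
  rw [ip, abs_div, abs_of_pos hn0, key, div_le_iff₀ hn0]
  have h1 := hn (freq θ)
  rw [← hS] at h1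
  have h2 := mul_le_mul (abs_cosAmp_le hθ) (Complex.abs_re_le_norm S) (abs_nonneg _) hM.le
  have h3 := mul_le_mul (abs_sinAmp_le hθ) (Complex.abs_im_le_norm S) (abs_nonneg _) hM.le
  refine (abs_add_le _ _).trans ?_
  rw [abs_mul, abs_mul]
  have h4 : 2 * M * ‖S‖ ≤ 2 * M * (ε / (2 * M) * n) := mul_le_mul_of_nonneg_left h1 (by positivity)
  have e : 2 * M * (ε / (2 * M) * n) = ε * n := by field_simp
  linarith

/-- Components with nonresonant frequency differences and sums are asymptotically exclusive. -/
lemma HasResonances.exclusive {ψ : ℕ → ℝ} {K : Submonoid ℕ} (h : HasResonances ψ K) {M : ℝ}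
    (hM : 0 < M) {ϑ ϑ' : Component} (hϑ : ϑ ∈ paramSpace M) (hϑ' : ϑ' ∈ paramSpace M)
    (hsub : Nonresonant K (freq ϑ - freq ϑ')) (hadd : Nonresonant K (freq ϑ + freq ϑ'))
    {ε : ℝ} (hε : 0 < ε) :
    ∀ᶠ n in atTop, ∀ θ ∈ paramSpace M,
      |ip n (atom ψ ϑ) (atom ψ θ)| < ε ∨ |ip n (atom ψ ϑ') (atom ψ θ)| < ε := by
  set δ := ε / (4 * M ^ 2) with hδ
  have hδ0 : 0 < δ := by positivity
  filter_upwards [h.eventually_lt_or_lt hsub hδ0, h.eventually_lt_or_lt hadd hδ0,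
    eventually_ge_atTop 1] with n h1 h2 hn1 θ hθ
  have hn0 : (0 : ℝ) < n := by exact_mod_cast hn1
  set E : ℝ → ℝ := fun γ => ‖∑ t ∈ Finset.Icc 1 n, cis (γ * ψ t)‖ with hE
  have hEneg : ∀ γ, E (-γ) = E γ := fun γ => by
    simp only [hE, neg_mul]; exact norm_sum_cis_neg _ _
  have key : ∀ η ∈ paramSpace M, E (freq η + freq θ) < δ * n → E (freq η - freq θ) < δ * n →
      |ip n (atom ψ η) (atom ψ θ)| < ε := by
    intro η hη ha hb
    refine (abs_ip_atom_atom_le hη hθ ψ ψ n).trans_lt ?_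
    simp only [← add_mul, ← sub_mul]
    rw [div_lt_iff₀ hn0]
    have e : ε * n = 2 * M ^ 2 * (δ * n + δ * n) := by rw [hδ]; field_simp; ring
    rw [e]
    exact mul_lt_mul_of_pos_left (add_lt_add ha hb) (by positivity)
  by_contra! hcon
  have c1 : δ * n ≤ E (freq ϑ + freq θ) ∨ δ * n ≤ E (freq ϑ - freq θ) := by
    by_contra! hc
    exact absurd (key ϑ hϑ hc.1 hc.2) (not_lt.2 hcon.1)
  have c2 : δ * n ≤ E (freq ϑ' + freq θ) ∨ δ * n ≤ E (freq ϑ' - freq θ) := by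
    by_contra! hc
    exact absurd (key ϑ' hϑ' hc.1 hc.2) (not_lt.2 hcon.2)
  have h1' : ∀ γ₁ γ₂ : ℝ, γ₁ - γ₂ = freq ϑ - freq ϑ' → δ * n ≤ E γ₁ → δ * n ≤ E γ₂ → False :=
    fun γ₁ γ₂ e a b => (h1 γ₁ γ₂ e).elim (not_lt.2 a) (not_lt.2 b)
  have h2' : ∀ γ₁ γ₂ : ℝ, γ₁ - γ₂ = freq ϑ + freq ϑ' → δ * n ≤ E γ₁ → δ * n ≤ E γ₂ → False :=
    fun γ₁ γ₂ e a b => (h2 γ₁ γ₂ e).elim (not_lt.2 a) (not_lt.2 b)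
  -- Equal signs resonate at the difference of the two frequencies; opposite signs, after reflecting
  -- one phase, at their sum.
  rcases c1 with c1 | c1 <;> rcases c2 with c2 | c2
  · exact h1' _ _ (by ring) c1 c2
  · exact h2' _ _ (by ring) c1 ((hEneg _).symm ▸ c2)
  · exact h2' _ _ (by ring) c1 ((hEneg _).symm ▸ c2)
  · exact h1' _ _ (by ring) c1 c2

/-- The power of a component whose doubled frequency is nonresonant. -/
lemma HasResonances.tendsto_ip_self {ψ : ℕ → ℝ} {K : Submonoid ℕ} (h : HasResonances ψ K)
    {θ : Component} (hθ : Nonresonant K (2 * freq θ)) :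
    Tendsto (fun n => ip n (atom ψ θ) (atom ψ θ)) atTop
      (𝓝 ((cosAmp θ ^ 2 + sinAmp θ ^ 2) / 2)) := by
  set R := cosAmp θ ^ 2 + sinAmp θ ^ 2 with hR
  have hR0 : 0 ≤ R := by positivity
  rw [Metric.tendsto_atTop']
  intro ε hε
  obtain ⟨N, hN⟩ := eventually_atTop.1 (h.eventually_lt hθ (ε := ε / (R + 1)) (by positivity))
  refine ⟨N, fun n hn => ?_⟩
  have hn0 : (0 : ℝ) < n := by exact_mod_cast (Nat.zero_le N).trans_lt hn
  have h1 := hN n (le_of_lt hn)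
  set S := ∑ t ∈ Finset.Icc 1 n, cis (2 * freq θ * ψ t) with hS
  have key : ip n (atom ψ θ) (atom ψ θ) - R / 2 =
      ((cosAmp θ ^ 2 - sinAmp θ ^ 2) / 2 * S.re + cosAmp θ * sinAmp θ * S.im) / n := by
    rw [ip, eq_div_iff hn0.ne', sub_mul, div_mul_cancel₀ _ hn0.ne']
    have e : R / 2 * n = ∑ t ∈ Finset.Icc 1 n, R / 2 := by simp; ring
    rw [e, ← Finset.sum_sub_distrib]
    simp only [hS, Complex.re_sum, Complex.im_sum, cis_re, cis_im, Finset.mul_sum,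
      ← Finset.sum_add_distrib]
    refine Finset.sum_congr rfl fun t _ => ?_
    rw [mul_assoc 2, Real.cos_two_mul, Real.sin_two_mul, atom, hR]
    have := Real.sin_sq_add_cos_sq (freq θ * ψ t)
    linear_combination (sinAmp θ ^ 2) * this
  rw [Real.dist_eq, key, abs_div, abs_of_pos hn0, div_lt_iff₀ hn0]
  have h2 := Complex.abs_re_le_norm S
  have h3 := Complex.abs_im_le_norm S
  have h4 : |(cosAmp θ ^ 2 - sinAmp θ ^ 2) / 2| ≤ R / 2 := by
    rw [abs_le]; constructor <;> nlinarith [sq_nonneg (cosAmp θ), sq_nonneg (sinAmp θ)]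
  have h5 : |cosAmp θ * sinAmp θ| ≤ R / 2 := by
    rw [abs_le]
    constructor <;> nlinarith [sq_nonneg (cosAmp θ - sinAmp θ), sq_nonneg (cosAmp θ + sinAmp θ)]
  refine (abs_add_le _ _).trans_lt ?_
  rw [abs_mul, abs_mul]
  have h6 := mul_le_mul h4 h2 (abs_nonneg _) (by positivity)
  have h7 := mul_le_mul h5 h3 (abs_nonneg _) (by positivity)
  have h8 : R * ‖S‖ ≤ R * (ε / (R + 1) * n) := mul_le_mul_of_nonneg_left h1.le hR0
  have h9 : R * (ε / (R + 1) * n) < ε * n := by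
    have : ε * n - R * (ε / (R + 1) * n) = ε * n / (R + 1) := by field_simp; ring
    have h10 : 0 < ε * n / (R + 1) := by positivity
    linarith
  linarith

lemma nonresonant_of_irrational {γ : ℝ} (h : Irrational (γ / Real.pi)) :
    Nonresonant (nonZeroDivisors ℕ) γ := by
  intro k hk hk1
  have hk0 : (k : ℝ) ≠ 0 := by exact_mod_cast nonZeroDivisors.ne_zero hk
  obtain ⟨m, hm⟩ := Complex.exp_eq_one_iff.1 hk1
  have h2 : ((k * γ : ℝ) : ℂ) = ((m * (2 * Real.pi) : ℝ) : ℂ) := by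
    have := mul_right_cancel₀ Complex.I_ne_zero (hm.trans (by ring :
      (m : ℂ) * (2 * Real.pi * Complex.I) = ((m : ℂ) * (2 * Real.pi)) * Complex.I))
    rw [this]; push_cast; ring
  have h3 : k * γ = m * (2 * Real.pi) := by exact_mod_cast h2
  refine h ⟨(2 * m / k : ℚ), ?_⟩
  push_cast
  rw [div_eq_div_iff hk0 Real.pi_ne_zero]
  linarith

lemma Nonresonant.natCast_mul {γ : ℝ} (h : Nonresonant (nonZeroDivisors ℕ) γ) {k : ℕ}
    (hk : k ≠ 0) : Nonresonant (nonZeroDivisors ℕ) (k * γ) := by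
  intro l hl
  have := h (l * k) (mul_mem hl (mem_nonZeroDivisors_of_ne_zero hk))
  rwa [Nat.cast_mul, mul_assoc] at this

/-- The only denominator in ⊥ is 1, and 0 is the only multiple of 2π in this range. -/
lemma nonresonant_bot_of_abs_lt {γ : ℝ} (h0 : γ ≠ 0) (h1 : |γ| < 2 * Real.pi) :
    Nonresonant ⊥ γ := by
  intro k hk hk1
  rw [Submonoid.mem_bot.1 hk, Nat.cast_one, one_mul] at hk1
  have hc : Real.cos γ = 1 := by rw [← cis_re, hk1, Complex.one_re]
  rw [abs_lt] at h1
  exact h0 ((Real.cos_eq_one_iff_of_lt_of_lt (by linarith) h1.2).1 hc)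

/-- A chirp of irrational rate is uniformly uncorrelated with sinusoids. -/
lemma uniformNull_chirp {M : ℝ} (hM : 0 < M) {ξ : Component} (hξ : ξ ∈ paramSpace M)
    (hirr : Irrational (freq ξ / Real.pi)) :
    UniformNull (fun t => (t : ℝ)) M fun _ => chirp ξ := by
  -- The resonance condition does not involve the linear coefficient α, whence the uniformity in the
  -- frequency of the sinusoid.
  have small : ∀ ε > 0, ∀ᶠ n : ℕ in atTop, ∀ α : ℝ,
      ‖∑ t ∈ Finset.Icc 1 n, cis (freq ξ * (t : ℝ) ^ 2 + α * t)‖ < ε * n := by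
    intro ε hε
    obtain ⟨H, C, hHC⟩ := exists_resonance_quadratic hε
    obtain ⟨c, hc, hcK⟩ :=
      ((nonresonant_of_irrational hirr).natCast_mul two_ne_zero).exists_le H
    filter_upwards [hHC, eventually_div_lt C hc] with n h1 h2 α
    by_contra hcon
    rw [norm_sum_Icc_quadratic_one] at hcon
    obtain ⟨k, hk, hkH, h3⟩ := h1 _ _ (not_lt.1 hcon)
    have := hcK k (mem_nonZeroDivisors_of_ne_zero (by omega)) hkH
    push_cast at this
    linarith
  intro ε hε
  filter_upwards [small (ε / (4 * M ^ 2)) (by positivity), eventually_ge_atTop 1]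
    with n hn hn1 θ hθ
  have hn0 : (0 : ℝ) < n := by exact_mod_cast hn1
  rw [chirp_eq_atom]
  refine (abs_ip_atom_atom_le hξ hθ _ _ n).trans ?_
  rw [div_le_iff₀ hn0]
  have h1 := hn (freq θ)
  have h2 := hn (-freq θ)
  simp only [neg_mul, ← sub_eq_add_neg] at h2
  have e : ε * n = 2 * M ^ 2 * (ε / (4 * M ^ 2) * n + ε / (4 * M ^ 2) * n) := by
    field_simp; ring
  rw [e]
  exact mul_le_mul_of_nonneg_left (add_le_add h1.le h2.le) (by positivity)

/-! ### Components of small power -/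

lemma abs_sin_add_le (x y : ℝ) : |Real.sin (x + y)| ≤ |Real.sin x| + |Real.sin y| := by
  rw [Real.sin_add]
  refine (abs_add_le _ _).trans ?_
  rw [abs_mul, abs_mul]
  exact add_le_add (mul_le_of_le_one_right (abs_nonneg _) (Real.abs_cos_le_one _))
    (mul_le_of_le_one_left (abs_nonneg _) (Real.abs_cos_le_one _))

lemma abs_sin_sub_le (x y : ℝ) : |Real.sin (x - y)| ≤ |Real.sin x| + |Real.sin y| := by
  simpa [sub_eq_add_neg] using abs_sin_add_le x (-y)

lemma abs_sin_natCast_mul_le (k : ℕ) (x : ℝ) : |Real.sin (k * x)| ≤ k * |Real.sin x| := by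
  induction k with
  | zero => simp
  | succ k ih =>
    push_cast
    rw [add_mul, one_mul, add_mul, one_mul]
    exact (abs_sin_add_le _ _).trans (by linarith)

/-- Subtracting the nearest multiple of π and then taking the absolute value changes only signs of
sines, for all h at once. -/
lemma exists_abs_sin_eq (x : ℝ) : ∃ y : ℝ, 0 ≤ y ∧ y ≤ Real.pi / 2 ∧
    ∀ h : ℕ, |Real.sin (h * x)| = |Real.sin (h * y)| := by
  have hpi := Real.pi_pos
  set w := x - round (x / Real.pi) * Real.pi with hw
  refine ⟨|w|, abs_nonneg _, ?_, fun h => ?_⟩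
  · have h1 := abs_sub_round (x / Real.pi)
    have e : w = (x / Real.pi - round (x / Real.pi)) * Real.pi := by rw [hw]; field_simp
    rw [e, abs_mul, abs_of_pos hpi]
    linarith [mul_le_mul_of_nonneg_right h1 hpi.le]
  · have e : (h : ℝ) * x = h * w + ((h * round (x / Real.pi) : ℤ) : ℝ) * Real.pi := by
      rw [hw]; push_cast; ring
    have e2 : |Real.sin (h * |w|)| = |Real.sin (h * w)| := by
      rcases abs_choice w with h1 | h1 <;> simp [h1]
    rw [e2, e, Real.sin_add_int_mul_pi, abs_mul]
    simp

/-- If the sines of the first `L` multiples of `x` are small, then `sin x` is smaller by `L`. -/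
lemma mul_abs_sin_le {x s : ℝ} {L : ℕ} (hL : 1 ≤ L) (hs : s < 1 / 2)
    (h : ∀ k : ℕ, 1 ≤ k → k ≤ L → |Real.sin (k * x)| ≤ s) : L * |Real.sin x| ≤ 2 * s := by
  have hpi := Real.pi_pos
  obtain ⟨y, hy0, hy1, hxy⟩ := exists_abs_sin_eq x
  have e := hxy 1
  simp only [Nat.cast_one, one_mul] at e
  rw [e]
  simp only [hxy] at h
  rcases hy0.eq_or_lt with rfl | hy0
  · have := h 1 le_rfl hL
    simp at this
    simp [this]
  -- If L y ≤ π/2, Jordan's inequality applies at L y. Otherwise the last multiple of y up to π/2 is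
  -- at least π/4 and its sine at least 1/2, against `hs`.
  by_cases hLy : L * y ≤ Real.pi / 2
  · have h1 := Real.mul_le_sin (by positivity) hLy
    have h2 := (le_abs_self _).trans (h L hL le_rfl)
    have h3 : |Real.sin y| ≤ y := by
      rw [abs_of_nonneg (Real.sin_nonneg_of_nonneg_of_le_pi hy0.le (by linarith))]
      exact Real.sin_le hy0.le
    have h4 : 2 / Real.pi * (L * y) ≤ s := h1.trans h2
    have h5 : (L : ℝ) * |Real.sin y| ≤ L * y := by gcongr
    have h6 : 1 / 2 * (L * y) ≤ 2 / Real.pi * (L * y) := by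
      refine mul_le_mul_of_nonneg_right ?_ (by positivity)
      rw [div_le_div_iff₀ (by norm_num) hpi]
      linarith [Real.pi_le_four]
    linarith
  · exfalso
    have h0 : 1 ≤ Real.pi / 2 / y := by rwa [le_div_iff₀ hy0, one_mul]
    set k := ⌊Real.pi / 2 / y⌋₊ with hk
    have hk1 : 1 ≤ k := Nat.one_le_floor_iff _ |>.2 h0
    have hk2 : (k : ℝ) * y ≤ Real.pi / 2 := by
      rw [← le_div_iff₀ hy0]; exact Nat.floor_le (by linarith)
    have hk3 : Real.pi / 2 < (k + 1) * y := by
      rw [← div_lt_iff₀ hy0]; exact Nat.lt_floor_add_one _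
    have hkL : k ≤ L := by
      by_contra hc
      push Not at hc hLy
      have : (L : ℝ) * y ≤ k * y := by gcongr
      linarith
    have hky : Real.pi / 4 ≤ k * y := by
      have : y ≤ k * y := by
        have : (1 : ℝ) ≤ k := by exact_mod_cast hk1
        nlinarith
      linarith
    have h1 := Real.mul_le_sin (by positivity) hk2
    have h2 := (le_abs_self _).trans (h k hk1 hkL)
    have h3 : 2 / Real.pi * (Real.pi / 4) ≤ 2 / Real.pi * (k * y) := by gcongr
    have h4 : 2 / Real.pi * (Real.pi / 4) = 1 / 2 := by field_simp; norm_num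
    linarith

/-- Cramer's rule: two samples determine both amplitudes, and up to sign the determinant is the sine
of the phase difference. -/
lemma abs_amp_mul_abs_sin_le {ψ : ℕ → ℝ} {θ : Component} {a : ℝ}
    (ha : a = |cosAmp θ| ∨ a = |sinAmp θ|) (s t : ℕ) :
    a * |Real.sin (freq θ * ψ s - freq θ * ψ t)| ≤ |atom ψ θ s| + |atom ψ θ t| := by
  set x := freq θ * ψ s with hx
  set y := freq θ * ψ t with hy
  have hmul : ∀ {u v c d : ℝ}, |c| ≤ 1 → |d| ≤ 1 → |u * c - v * d| ≤ |u| + |v| := by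
    intro u v c d hc hd
    refine (abs_sub _ _).trans ?_
    rw [abs_mul, abs_mul]
    exact add_le_add (mul_le_of_le_one_right (abs_nonneg _) hc)
      (mul_le_of_le_one_right (abs_nonneg _) hd)
  have h2 := Real.sin_sq_add_cos_sq x
  have h3 := Real.sin_sq_add_cos_sq y
  rcases ha with rfl | rfl <;> rw [← abs_mul]
  · have e : cosAmp θ * Real.sin (x - y) =
        -(atom ψ θ s * Real.sin y - atom ψ θ t * Real.sin x) := by
      simp only [atom, ← hx, ← hy, Real.sin_sub]; ring
    rw [e, abs_neg]
    exact hmul (Real.abs_sin_le_one _) (Real.abs_sin_le_one _)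
  · have e : sinAmp θ * Real.sin (x - y) =
        atom ψ θ s * Real.cos y - atom ψ θ t * Real.cos x := by
      simp only [atom, ← hx, ← hy, Real.sin_sub]; ring
    rw [e]
    exact hmul (Real.abs_cos_le_one _) (Real.abs_cos_le_one _)

lemma sum_abs_le (n : ℕ) (f : ℕ → ℝ) :
    ∑ t ∈ Finset.Icc 1 n, |f t| ≤ n * √(ip n f f) := by
  rcases n.eq_zero_or_pos with rfl | hn
  · simp
  have hn0 : (0 : ℝ) < n := by exact_mod_cast hn
  have h1 := Finset.sum_mul_sq_le_sq_mul_sq (Finset.Icc 1 n) (fun _ => (1 : ℝ)) (fun t => |f t|)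
  simp only [one_mul, one_pow, Finset.sum_const, Nat.card_Icc, Nat.add_sub_cancel, sq_abs,
    nsmul_eq_mul, mul_one] at h1
  refine abs_le_of_sq_le_sq' ?_ (by positivity) |>.2
  rw [mul_pow, Real.sq_sqrt (ip_self_nonneg _ _), ip]
  refine h1.trans (le_of_eq ?_)
  simp only [← sq]
  field_simp

lemma sum_shift_le {n h L : ℕ} (hL : L + h ≤ n) {f : ℕ → ℝ} (hf : ∀ t, 0 ≤ f t) :
    ∑ t ∈ Finset.Icc 1 L, f (t + h) ≤ ∑ t ∈ Finset.Icc 1 n, f t := by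
  have : ∑ t ∈ Finset.Icc 1 L, f (t + h) = ∑ t ∈ (Finset.Icc 1 L).map (addRightEmbedding h), f t := by
    simp only [Finset.sum_map, addRightEmbedding_apply]
  rw [this]
  refine Finset.sum_le_sum_of_subset_of_nonneg (fun t ht => ?_) fun t _ _ => hf t
  simp only [Finset.mem_map, Finset.mem_Icc, addRightEmbedding_apply] at ht ⊢
  obtain ⟨u, hu, rfl⟩ := ht
  omega

/-- If each of more than half of the terms is bounded below by `c`, then so is twice the mean. -/
lemma const_le_of_forall_le {n h m : ℕ} (hn : 0 < n) (hh : 2 * h ≤ n) {f : ℕ → ℝ} {c : ℝ}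
    (S : Fin m → ℕ) (hS : ∀ i, S i ≤ h)
    (hc : ∀ t ≤ n, c ≤ ∑ i, |f (t + S i)|) : c ≤ 2 * m * √(ip n f f) := by
  have hn0 : (0 : ℝ) < n := by exact_mod_cast hn
  set r := √(ip n f f) with hr
  have hr0 : 0 ≤ r := Real.sqrt_nonneg _
  have h1 : ((n - h : ℕ) : ℝ) * c ≤ m * (n * r) := by
    calc ((n - h : ℕ) : ℝ) * c = ∑ t ∈ Finset.Icc 1 (n - h), c := by simp
      _ ≤ ∑ t ∈ Finset.Icc 1 (n - h), ∑ i, |f (t + S i)| := Finset.sum_le_sum fun t ht =>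
          hc t ((Finset.mem_Icc.1 ht).2.trans (Nat.sub_le _ _))
      _ = ∑ i, ∑ t ∈ Finset.Icc 1 (n - h), |f (t + S i)| := Finset.sum_comm
      _ ≤ ∑ i : Fin m, n * r := Finset.sum_le_sum fun i _ =>
          (sum_shift_le (by have := hS i; omega) fun t => abs_nonneg (f t)).trans (sum_abs_le n f)
      _ = m * (n * r) := by simp
  by_cases hc0 : c ≤ 0
  · exact hc0.trans (by positivity)
  · have h2 : (n : ℝ) / 2 ≤ ((n - h : ℕ) : ℝ) := by
      rw [Nat.cast_sub (by omega)]
      have : (2 : ℝ) * h ≤ n := by exact_mod_cast hh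
      linarith
    have h3 : (n : ℝ) / 2 * c ≤ m * (n * r) := (mul_le_mul_of_nonneg_right h2 (by linarith)).trans h1
    have h4 : (n : ℝ) * c ≤ n * (2 * m * r) := by linarith
    exact le_of_mul_le_mul_left h4 hn0

/-- A component of small power but nonsmall amplitude has its frequency within `o(n ^ (-d))` of an
endpoint. -/
def EndpointDegenerate (ψ : ℕ → ℝ) (d : ℕ) : Prop :=
  ∀ ε > 0, ∃ κ > 0, ∃ C : ℝ, ∀ᶠ n : ℕ in atTop, ∀ θ : Component, ∀ a : ℝ,
    (a = |cosAmp θ| ∨ a = |sinAmp θ|) → ε ≤ a → √(ip n (atom ψ θ) (atom ψ θ)) < κ →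
      (n : ℝ) ^ d * |Real.sin (freq θ)| ≤ C * √(ip n (atom ψ θ) (atom ψ θ))

lemma endpointDegenerate_linear : EndpointDegenerate (fun t => (t : ℝ)) 1 := by
  intro ε hε
  refine ⟨ε / 8, by positivity, 32 / ε, ?_⟩
  filter_upwards [eventually_ge_atTop 2] with n hn θ a ha hεa hr
  set r := √(ip n (atom (fun t => (t : ℝ)) θ) (atom (fun t => (t : ℝ)) θ)) with hr'
  have hr0 : 0 ≤ r := Real.sqrt_nonneg _
  -- A shift by k changes the phase by the same amount at every t, so the two-sample bound can be
  -- averaged over t.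
  have h1 : ∀ k : ℕ, 1 ≤ k → k ≤ n / 2 → |Real.sin (k * freq θ)| ≤ 4 * r / ε := by
    intro k _ hk
    rw [le_div_iff₀ hε, mul_comm]
    refine (mul_le_mul_of_nonneg_right hεa (abs_nonneg _)).trans ?_
    refine (const_le_of_forall_le (n := n) (h := k) (m := 2)
      (f := atom (fun t => (t : ℝ)) θ) (by omega) (by omega)
      ![k, 0] (fun i => by fin_cases i <;> simp) fun t _ => ?_).trans (by push_cast; linarith)
    have := abs_amp_mul_abs_sin_le (ψ := fun t => (t : ℝ)) ha (t + k) t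
    have e : freq θ * ((t + k : ℕ) : ℝ) - freq θ * (t : ℝ) = k * freq θ := by push_cast; ring
    rw [e] at this
    simpa [Fin.sum_univ_two] using this
  have h2 := mul_abs_sin_le (by omega) (by rw [div_lt_iff₀ hε]; linarith) h1
  have h3 : (n : ℝ) ≤ 4 * ((n / 2 : ℕ) : ℝ) := by
    have : n ≤ 4 * (n / 2) := by omega
    exact_mod_cast this
  have h4 := mul_le_mul_of_nonneg_right h3 (abs_nonneg (Real.sin (freq θ)))
  have e : 32 / ε * r = 4 * (2 * (4 * r / ε)) := by ring
  rw [pow_one, e]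
  linarith

lemma endpointDegenerate_square : EndpointDegenerate (fun t => (t : ℝ) ^ 2) 2 := by
  intro ε hε
  refine ⟨ε / 4112, by positivity, 2048 / ε, ?_⟩
  filter_upwards [eventually_ge_atTop 4] with n hn θ a ha hεa hr
  set g := atom (fun t => (t : ℝ) ^ 2) θ with hg
  set r := √(ip n g g) with hr'
  set lam := freq θ with hlam
  have hr0 : 0 ≤ r := Real.sqrt_nonneg _
  have hn0 : (0 : ℝ) < n := by positivity
  set s := 8 * r / ε with hs
  have hs0 : 0 ≤ s := by positivity
  have hs1 : s < 1 / 514 := by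
    rw [hs, div_lt_iff₀ hε]; linarith
  set L := n / 4 with hL
  have hL1 : 1 ≤ L := by omega
  have hL1' : (1 : ℝ) ≤ L := by exact_mod_cast hL1
  have hnL : (n : ℝ) ≤ 8 * L := by
    have : n ≤ 8 * L := by omega
    exact_mod_cast this
  -- The second difference of t² with steps h and k is 2hk at every t, which takes four samples.
  have h1 : ∀ h k : ℕ, h ≤ L → k ≤ L → |Real.sin (k * (h * (2 * lam)))| ≤ s := by
    intro h k hh hk
    rw [hs, le_div_iff₀ hε, mul_comm]
    refine (mul_le_mul_of_nonneg_right hεa (abs_nonneg _)).trans ?_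
    refine (const_le_of_forall_le (n := n) (h := h + k) (m := 4) (f := g) (by omega) (by omega)
      ![h + k, k, h, 0] (fun i => by fin_cases i <;> simp) fun t _ => ?_).trans
        (by push_cast; linarith)
    have ha0 : 0 ≤ a := hε.le.trans hεa
    have b1 := abs_amp_mul_abs_sin_le (ψ := fun t => (t : ℝ) ^ 2) ha (t + (h + k)) (t + k)
    have b2 := abs_amp_mul_abs_sin_le (ψ := fun t => (t : ℝ) ^ 2) ha (t + h) t
    have e : (k : ℝ) * (h * (2 * lam)) =
        (freq θ * ((t + (h + k) : ℕ) : ℝ) ^ 2 - freq θ * ((t + k : ℕ) : ℝ) ^ 2) -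
        (freq θ * ((t + h : ℕ) : ℝ) ^ 2 - freq θ * (t : ℝ) ^ 2) := by
      rw [hlam]; push_cast; ring
    rw [e]
    refine (mul_le_mul_of_nonneg_left (abs_sin_sub_le _ _) ha0).trans ?_
    simp only [Fin.sum_univ_four, Matrix.cons_val, add_zero]
    rw [← hg] at b1 b2
    linarith
  -- `mul_abs_sin_le` is used once over k and once over h, each time gaining a factor L.
  have h2 : ∀ h : ℕ, 1 ≤ h → h ≤ L → |Real.sin (h * (2 * lam))| ≤ 2 * s / L := by
    intro h _ hh
    rw [le_div_iff₀ (by linarith), mul_comm]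
    exact mul_abs_sin_le hL1 (by linarith) fun k _ hk => h1 h k hh hk
  have h3 : L * |Real.sin (2 * lam)| ≤ 2 * (2 * s / L) := by
    refine mul_abs_sin_le hL1 ?_ h2
    rw [div_lt_iff₀ (by linarith)]
    linarith
  have h4 : (n : ℝ) ^ 2 * |Real.sin (2 * lam)| ≤ 256 * s := by
    have h5 : (L : ℝ) * (L * |Real.sin (2 * lam)|) ≤ 4 * s := by
      refine (mul_le_mul_of_nonneg_left h3 (by linarith)).trans (le_of_eq ?_)
      field_simp; ring
    have h6 : (n : ℝ) ^ 2 ≤ (8 * L) ^ 2 := pow_le_pow_left₀ hn0.le hnL 2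
    have h7 := mul_le_mul_of_nonneg_right h6 (abs_nonneg (Real.sin (2 * lam)))
    linarith
  have ha0 : 0 < a := hε.trans_le hεa
  have hn1 : (1 : ℝ) ≤ n := by exact_mod_cast (by omega : 1 ≤ n)
  -- A small sin (2λ) only puts λ near a multiple of π/2. The first differences of the phase, (2t +
  -- 1)λ, exclude the odd multiples.
  have h5 : a * (|Real.sin lam| - 256 * s) ≤ 4 * r := by
    refine (const_le_of_forall_le (n := n) (h := 1) (m := 2) (f := g) (by omega) (by omega)
      ![1, 0] (fun i => by fin_cases i <;> simp) fun t ht => ?_).trans (by push_cast; linarith)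
    have b1 := abs_amp_mul_abs_sin_le (ψ := fun t => (t : ℝ) ^ 2) ha (t + 1) t
    have e : freq θ * ((t + 1 : ℕ) : ℝ) ^ 2 - freq θ * (t : ℝ) ^ 2 = lam + t * (2 * lam) := by
      rw [hlam]; push_cast; ring
    rw [e] at b1
    have b2 := abs_sin_sub_le (lam + t * (2 * lam)) (t * (2 * lam))
    rw [add_sub_cancel_right] at b2
    have b3 : |Real.sin (t * (2 * lam))| ≤ 256 * s := by
      refine (abs_sin_natCast_mul_le t _).trans (le_trans ?_ h4)
      refine mul_le_mul_of_nonneg_right ?_ (abs_nonneg _)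
      have : (t : ℝ) ≤ n := by exact_mod_cast ht
      nlinarith
    have b4 : a * (|Real.sin lam| - 256 * s) ≤ a * |Real.sin (lam + t * (2 * lam))| :=
      mul_le_mul_of_nonneg_left (by linarith) ha0.le
    simpa [Fin.sum_univ_two] using b4.trans b1
  have h6 : |Real.sin lam| ≤ 257 * s := by
    by_contra hcon
    have c1 : ε * s ≤ 4 * r := by
      refine le_trans ?_ h5
      exact mul_le_mul hεa (by linarith) hs0 ha0.le
    have c2 : ε * s = 8 * r := by rw [hs]; field_simp
    have c3 : r = 0 := by linarith
    have c4 : s = 0 := by rw [hs, c3]; simp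
    rw [c3, c4] at h5
    rw [c4] at hcon
    nlinarith
  -- The choice κ = ε/4112 gives 257 s < 1/2, so cos λ is bounded below and sin (2λ) controls sin λ.
  have h7 : 1 / 2 ≤ |Real.cos lam| := by
    refine abs_le_of_sq_le_sq' (b := |Real.cos lam|) ?_ (abs_nonneg _) |>.2
    have c1 : |Real.sin lam| ^ 2 ≤ (1 / 2) ^ 2 :=
      pow_le_pow_left₀ (abs_nonneg _) (by linarith) 2
    rw [sq_abs] at c1 ⊢
    have := Real.sin_sq_add_cos_sq lam
    linarith
  have h8 : |Real.sin lam| ≤ |Real.sin (2 * lam)| := by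
    rw [Real.sin_two_mul, abs_mul, abs_mul, abs_two]
    nlinarith [abs_nonneg (Real.sin lam)]
  have e : 2048 / ε * r = 256 * s := by rw [hs]; ring
  rw [e]
  exact (mul_le_mul_of_nonneg_left h8 (by positivity)).trans h4

/-- Fits of vanishing power have a vanishing cosine amplitude, and a vanishing sine amplitude along
sample sizes at which the frequency stays away from the endpoints. -/
lemma EndpointDegenerate.tendsto_amp {ψ : ℕ → ℝ} {d : ℕ} (h : EndpointDegenerate ψ d)
    (hψ : ∀ t : ℕ, ψ t = ((t ^ d : ℕ) : ℝ)) {M : ℝ} {est : ℕ → Component}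
    (hest : ∀ n, est n ∈ paramSpace M)
    (hpow : Tendsto (fun n => ip n (atom ψ (est n)) (atom ψ (est n))) atTop (𝓝 0)) :
    Tendsto (fun n => cosAmp (est n)) atTop (𝓝 0) ∧
      ∀ r : ℝ, 0 < r → Tendsto (fun n => sinAmp (est n))
        (atTop ⊓ 𝓟 {n : ℕ | r / (n : ℝ) ^ d ≤ freq (est n) ∧
          freq (est n) ≤ Real.pi - r / (n : ℝ) ^ d}) (𝓝 0) := by
  have hsqrt : Tendsto (fun n => √(ip n (atom ψ (est n)) (atom ψ (est n)))) atTop (𝓝 0) := by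
    simpa [Function.comp_def] using (Real.continuous_sqrt.tendsto 0).comp hpow
  have main : ∀ ε > 0, ∀ η > 0, ∀ᶠ n in atTop, ∀ a,
      (a = |cosAmp (est n)| ∨ a = |sinAmp (est n)|) → ε ≤ a →
        (n : ℝ) ^ d * |Real.sin (freq (est n))| < η := by
    intro ε hε η hη
    obtain ⟨κ, hκ, C, hC⟩ := h ε hε
    have hCs : Tendsto (fun n => C * √(ip n (atom ψ (est n)) (atom ψ (est n)))) atTop (𝓝 0) := by
      simpa using hsqrt.const_mul C
    filter_upwards [hC, hsqrt.eventually (gt_mem_nhds hκ), hCs.eventually (gt_mem_nhds hη)]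
      with n h1 h2 h3 a ha hεa
    exact (h1 _ a ha hεa h2).trans_lt h3
  have hM : 0 ≤ M := (abs_nonneg _).trans (abs_cosAmp_le (hest 0))
  constructor
  · rw [Metric.tendsto_atTop']
    intro ε hε
    refine (eventually_atTop.1 ?_).imp fun N hN n hn => hN n hn.le
    set η := min (1 / 2) (ε / (4 * (M + 1))) with hη
    have hη0 : 0 < η := by positivity
    filter_upwards [main ε hε η hη0, hsqrt.eventually (gt_mem_nhds (by positivity : 0 < ε / 4)),
      eventually_ge_atTop 1] with n h1 h2 hn1
    have hn0 : (0 : ℝ) < n := by exact_mod_cast hn1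
    rw [Real.dist_eq, sub_zero]
    by_contra hcon
    have h3 := h1 _ (Or.inl rfl) (not_lt.1 hcon)
    -- As |sin (t^d x)| ≤ t^d |sin x|, the sine of the phase is at most η at all times up to n: the
    -- sine term is at most ε/4, the cosine term at least ε/2.
    have h4 : ∀ t ∈ Finset.Icc 1 n, ε / 4 ≤ |atom ψ (est n) t| := by
      intro t ht
      have c1 : |Real.sin (freq (est n) * ψ t)| ≤ η := by
        rw [hψ, mul_comm]
        refine (abs_sin_natCast_mul_le _ _).trans (le_trans ?_ h3.le)
        refine mul_le_mul_of_nonneg_right ?_ (abs_nonneg _)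
        push_cast
        have : (t : ℝ) ≤ n := by exact_mod_cast (Finset.mem_Icc.1 ht).2
        gcongr
      have c2 : 1 / 2 ≤ |Real.cos (freq (est n) * ψ t)| := by
        refine abs_le_of_sq_le_sq' (b := |Real.cos (freq (est n) * ψ t)|) ?_ (abs_nonneg _) |>.2
        have : |Real.sin (freq (est n) * ψ t)| ^ 2 ≤ (1 / 2) ^ 2 :=
          pow_le_pow_left₀ (abs_nonneg _) (c1.trans (min_le_left _ _)) 2
        rw [sq_abs] at this ⊢
        have := Real.sin_sq_add_cos_sq (freq (est n) * ψ t)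
        linarith
      have c3 : ε * (1 / 2) ≤ |cosAmp (est n) * Real.cos (freq (est n) * ψ t)| := by
        rw [abs_mul]
        exact mul_le_mul (not_lt.1 hcon) c2 (by norm_num) (abs_nonneg _)
      have c4 : |sinAmp (est n) * Real.sin (freq (est n) * ψ t)| ≤ ε / 4 := by
        rw [abs_mul]
        have := mul_le_mul (abs_sinAmp_le (hest n)) (c1.trans (min_le_right _ _)) (abs_nonneg _) hM
        refine this.trans ?_
        rw [mul_div_assoc', div_le_div_iff₀ (by positivity) (by norm_num)]
        nlinarith
      have c5 := abs_sub_abs_le_abs_sub (cosAmp (est n) * Real.cos (freq (est n) * ψ t))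
        (-(sinAmp (est n) * Real.sin (freq (est n) * ψ t)))
      rw [abs_neg, sub_neg_eq_add] at c5
      rw [atom]
      linarith
    have h5 : ∑ t ∈ Finset.Icc 1 n, ε / 4 ≤ n * √(ip n (atom ψ (est n)) (atom ψ (est n))) :=
      (Finset.sum_le_sum h4).trans (sum_abs_le n _)
    rw [Finset.sum_const, Nat.card_Icc, Nat.add_sub_cancel, nsmul_eq_mul] at h5
    have := le_of_mul_le_mul_left h5 hn0
    linarith
  · intro r hr
    rw [Metric.tendsto_nhds]
    intro ε hε
    rw [eventually_inf_principal]
    have hpi := Real.pi_pos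
    filter_upwards [main ε hε (2 / Real.pi * r) (by positivity), eventually_ge_atTop 1]
      with n h1 hn1 hfreq
    have hn0 : (0 : ℝ) < (n : ℝ) ^ d := by positivity
    rw [Real.dist_eq, sub_zero]
    by_contra hcon
    have h2 := h1 _ (Or.inr rfl) (not_lt.1 hcon)
    -- Jordan's inequality on either half of [0, π]; the threshold 2r/π given to `main` is the one
    -- this contradicts.
    have h3 : 2 / Real.pi * (r / (n : ℝ) ^ d) ≤ |Real.sin (freq (est n))| := by
      refine le_trans ?_ (le_abs_self _)
      have hr0 : 0 < r / (n : ℝ) ^ d := by positivity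
      rcases le_total (freq (est n)) (Real.pi / 2) with hle | hle
      · refine le_trans ?_ (Real.mul_le_sin (by linarith [hfreq.1]) hle)
        exact mul_le_mul_of_nonneg_left hfreq.1 (by positivity)
      · rw [← Real.sin_pi_sub]
        refine le_trans ?_ (Real.mul_le_sin (by linarith [hfreq.2]) (by linarith))
        exact mul_le_mul_of_nonneg_left (by linarith [hfreq.2]) (by positivity)
    have h4 := mul_le_mul_of_nonneg_left h3 hn0.le
    have e : (n : ℝ) ^ d * (2 / Real.pi * (r / (n : ℝ) ^ d)) = 2 / Real.pi * r := by
      field_simp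
    linarith

/-! ### White noise: expected suprema over all phases -/

/-- Independent, centred, square integrable random variables with common second moment `w`. -/
structure IsWhiteNoise {Ω : Type*} [MeasurableSpace Ω] (μ : Measure Ω) (w : ℝ)
    (x : ℕ → Ω → ℝ) : Prop where
  indep : iIndepFun x μ
  memLp : ∀ t, MemLp (x t) 2 μ
  mean_eq : ∀ t, ∫ ω, x t ω ∂μ = 0
  sq_eq : ∀ t, ∫ ω, x t ω ^ 2 ∂μ = w

namespace IsWhiteNoise

variable {Ω : Type*} [MeasurableSpace Ω] {μ : Measure Ω} {w : ℝ} {x : ℕ → Ω → ℝ}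

lemma aemeasurable (hx : IsWhiteNoise μ w x) (t : ℕ) : AEMeasurable (x t) μ :=
  (hx.memLp t).aestronglyMeasurable.aemeasurable

lemma nonneg (hx : IsWhiteNoise μ w x) : 0 ≤ w := by
  rw [← hx.sq_eq 0]; exact integral_nonneg fun ω => sq_nonneg _

/-- The product of the values at the corners of a parallelogram of shifts. -/
def quad (x : ℕ → Ω → ℝ) (h k t : ℕ) (ω : Ω) : ℝ :=
  x t ω * x (t + h) ω * (x (t + k) ω * x (t + k + h) ω)

/-- The index t occurs once and all other indices exceed it, so the centred factor x t splits off.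
-/
lemma integral_quad_mul_quad (hx : IsWhiteNoise μ w x) {h k : ℕ} (hh : h ≠ 0) (hk : k ≠ 0)
    {t u : ℕ} (htu : t < u) : ∫ ω, quad x h k t ω * quad x h k u ω ∂μ = 0 := by
  set V : Finset ℕ := Finset.Ioc t (u + k + h) with hV
  have hind := hx.indep.indepFun_finset₀ {t} V
    (by rw [Finset.disjoint_singleton_left, hV]; simp) hx.aemeasurable
  set φ : (V → ℝ) → ℝ := fun z =>
    z ⟨t + h, by simp [hV]; omega⟩ * (z ⟨t + k, by simp [hV]; omega⟩ *
      z ⟨t + k + h, by simp [hV]; omega⟩) *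
    (z ⟨u, by simp [hV]; omega⟩ * z ⟨u + h, by simp [hV]; omega⟩ *
      (z ⟨u + k, by simp [hV]; omega⟩ * z ⟨u + k + h, by simp [hV]; omega⟩)) with hφ
  have hφm : Measurable φ := by fun_prop
  have hm₀ : Measurable fun z : ({t} : Finset ℕ) → ℝ => z ⟨t, by simp⟩ := by fun_prop
  have h2 := hind.comp hm₀ hφm
  have m := fun t => (hx.memLp t).aestronglyMeasurable
  have h3 := h2.integral_fun_mul_eq_mul_integral (m t)
    (((m _).mul ((m _).mul (m _))).mul (((m _).mul (m _)).mul ((m _).mul (m _))))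
  have e : ∀ ω, quad x h k t ω * quad x h k u ω =
      ((fun z : ({t} : Finset ℕ) → ℝ => z ⟨t, by simp⟩) ∘ fun a (i : ({t} : Finset ℕ)) => x i a) ω *
      (φ ∘ fun a (i : V) => x i a) ω := by
    intro ω
    simp only [quad, hφ, Function.comp]
    ring
  simp only [e]
  rw [h3]
  have : ∫ ω, ((fun z : ({t} : Finset ℕ) → ℝ => z ⟨t, by simp⟩) ∘
      fun a (i : ({t} : Finset ℕ)) => x i a) ω ∂μ = 0 := hx.mean_eq t
  rw [this, zero_mul]

variable [IsProbabilityMeasure μ]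

lemma prod_sq (hx : IsWhiteNoise μ w x) (s : Finset ℕ) :
    Integrable (fun ω => ∏ i ∈ s, x i ω ^ 2) μ ∧ ∫ ω, ∏ i ∈ s, x i ω ^ 2 ∂μ = w ^ s.card := by
  classical
  induction s using Finset.induction_on with
  | empty => simp
  | insert i s hi ih =>
    have hind : iIndepFun (fun t ω => x t ω ^ 2) μ :=
      hx.indep.comp (fun _ y => y ^ 2) fun _ => measurable_id.pow_const 2
    have h1 : IndepFun (∏ j ∈ s, fun ω => x j ω ^ 2) (fun ω => x i ω ^ 2) μ :=
      hind.indepFun_finsetProd_of_notMem₀ (fun t => (hx.aemeasurable t).pow_const 2) hi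
    have e : (∏ j ∈ s, fun ω => x j ω ^ 2) = fun ω => ∏ j ∈ s, x j ω ^ 2 := by
      ext ω; simp
    rw [e] at h1
    have hi2 : Integrable (fun ω => x i ω ^ 2) μ := (hx.memLp i).integrable_sq
    simp only [Finset.prod_insert hi]
    refine ⟨h1.symm.integrable_mul hi2 ih.1, ?_⟩
    rw [h1.symm.integral_fun_mul_eq_mul_integral hi2.aestronglyMeasurable
      ih.1.aestronglyMeasurable, ih.2, hx.sq_eq, Finset.card_insert_of_notMem hi, pow_succ]
    ring

lemma integrable_sq_mul_sq (hx : IsWhiteNoise μ w x) {s t : ℕ} (hst : s ≠ t) :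
    Integrable (fun ω => x s ω ^ 2 * x t ω ^ 2) μ ∧ ∫ ω, x s ω ^ 2 * x t ω ^ 2 ∂μ = w ^ 2 := by
  have := hx.prod_sq {s, t}
  simpa [Finset.prod_pair hst, Finset.card_pair hst] using this

/-- For h ≠ k the four times are distinct, so the square is a product of independent squares and
finite variance suffices. -/
lemma memLp_quad (hx : IsWhiteNoise μ w x) {h k : ℕ} (hh : h ≠ 0) (hk : k ≠ 0) (hhk : h ≠ k)
    (t : ℕ) : MemLp (quad x h k t) 2 μ ∧ ∫ ω, quad x h k t ω ^ 2 ∂μ = w ^ 4 := by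
  have hp := hx.prod_sq {t, t + h, t + k, t + k + h}
  have e : ∀ ω, ∏ i ∈ ({t, t + h, t + k, t + k + h} : Finset ℕ), x i ω ^ 2 =
      quad x h k t ω ^ 2 := by
    intro ω
    rw [Finset.prod_insert (by simp; omega), Finset.prod_insert (by simp; omega),
      Finset.prod_pair (by omega), quad]
    ring
  have ec : ({t, t + h, t + k, t + k + h} : Finset ℕ).card = 4 := by
    rw [Finset.card_insert_of_notMem (by simp; omega),
      Finset.card_insert_of_notMem (by simp; omega), Finset.card_pair (by omega)]
  simp only [e, ec] at hp
  refine ⟨(memLp_two_iff_integrable_sq ?_).2 hp.1, hp.2⟩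
  have m := fun t => (hx.memLp t).aestronglyMeasurable
  exact ((m _).mul (m _)).mul ((m _).mul (m _))

lemma integral_sq_sum_quad (hx : IsWhiteNoise μ w x) {h k : ℕ} (hh : h ≠ 0) (hk : k ≠ 0)
    (hhk : h ≠ k) (L : ℕ) :
    Integrable (fun ω => (∑ t ∈ Finset.range L, quad x h k t ω) ^ 2) μ ∧
      ∫ ω, (∑ t ∈ Finset.range L, quad x h k t ω) ^ 2 ∂μ = L * w ^ 4 := by
  have hm := fun t => (hx.memLp_quad hh hk hhk t).1
  have hint : ∀ t u, Integrable (fun ω => quad x h k t ω * quad x h k u ω) μ :=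
    fun t u => (hm t).integrable_mul (hm u)
  simp only [sq, Finset.sum_mul_sum]
  refine ⟨integrable_finsetSum _ fun t _ => integrable_finsetSum _ fun u _ => hint t u, ?_⟩
  rw [integral_finsetSum _ fun t _ => integrable_finsetSum _ fun u _ => hint t u]
  have : ∀ t ∈ Finset.range L,
      ∫ ω, ∑ u ∈ Finset.range L, quad x h k t ω * quad x h k u ω ∂μ = w ^ 4 := by
    intro t ht
    rw [integral_finsetSum _ fun u _ => hint t u, Finset.sum_eq_single_of_mem t ht]
    · simp only [← sq]; exact (hx.memLp_quad hh hk hhk t).2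
    · intro u _ hut
      rcases lt_or_gt_of_ne hut with h1 | h1
      · simp only [mul_comm (quad x h k t _)]
        exact hx.integral_quad_mul_quad hh hk h1
      · exact hx.integral_quad_mul_quad hh hk h1
  rw [Finset.sum_congr rfl this]
  simp


/-- The free weight r stands in for a square root, so that all majorants are explicit integrable
functions. -/
lemma two_mul_le_add_sq_div {V r : ℝ} (hr : 0 < r) : 2 * V ≤ r + V ^ 2 / r := by
  have : r + V ^ 2 / r - 2 * V = (r - V) ^ 2 / r := by field_simp; ring
  have h2 : 0 ≤ (r - V) ^ 2 / r := by positivity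
  linarith

lemma integral_const_add_div {f g : Ω → ℝ} (hf : Integrable f μ) (hg : Integrable g μ) {s : ℝ} :
    ∫ ω, (s + (f ω + g ω) / s) ∂μ = s + (∫ ω, f ω ∂μ + ∫ ω, g ω ∂μ) / s := by
  have := integral_add (integrable_const s) (g := fun ω => (f ω + g ω) / s)
    ((hf.add hg).div_const s)
  rw [this, integral_div, integral_add hf hg]
  simp

/-- Orthogonality of the summands handles h ≠ k. For h = k the time t + h is repeated and a square
would need fourth moments; only a first moment bound is used there. -/
lemma exists_bound_quad (hx : IsWhiteNoise μ w x) {h k : ℕ} (hh : h ≠ 0) (hk : k ≠ 0) (L : ℕ)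
    {v : ℝ} (hv : 0 < v) : ∃ Z : Ω → ℝ, Integrable Z μ ∧
      ∫ ω, Z ω ∂μ ≤ v + L * w ^ 4 / v + (if h = k then 2 * L * w ^ 2 else 0) ∧
      ∀ ω, 2 * |∑ t ∈ Finset.range L, quad x h k t ω| ≤ Z ω := by
  have hw := hx.nonneg
  by_cases hhk : h = k
  · subst hhk
    have h1 := fun t => hx.integrable_sq_mul_sq (s := t) (t := t + h) (by omega)
    have h2 := fun t => hx.integrable_sq_mul_sq (s := t + h + h) (t := t + h) (by omega)
    refine ⟨fun ω => ∑ t ∈ Finset.range L, (x t ω ^ 2 * x (t + h) ω ^ 2 +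
      x (t + h + h) ω ^ 2 * x (t + h) ω ^ 2),
      integrable_finsetSum _ fun t _ => (h1 t).1.add (h2 t).1, ?_, fun ω => ?_⟩
    · beta_reduce
      rw [integral_finsetSum (Finset.range L) (f := fun t ω => x t ω ^ 2 * x (t + h) ω ^ 2 +
        x (t + h + h) ω ^ 2 * x (t + h) ω ^ 2) fun t _ => (h1 t).1.add (h2 t).1]
      have : ∀ t ∈ Finset.range L, ∫ ω, (x t ω ^ 2 * x (t + h) ω ^ 2 +
          x (t + h + h) ω ^ 2 * x (t + h) ω ^ 2) ∂μ = w ^ 2 + w ^ 2 := fun t _ => by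
        rw [integral_add (h1 t).1 (h2 t).1, (h1 t).2, (h2 t).2]
      rw [Finset.sum_congr rfl this]
      simp only [Finset.sum_const, Finset.card_range, nsmul_eq_mul, if_true]
      have : 0 ≤ v + L * w ^ 4 / v := by positivity
      linarith
    · refine (mul_le_mul_of_nonneg_left (Finset.abs_sum_le_sum_abs _ _) zero_le_two).trans ?_
      rw [Finset.mul_sum]
      refine Finset.sum_le_sum fun t _ => ?_
      have e : quad x h h t ω = (x t ω * x (t + h + h) ω) * x (t + h) ω ^ 2 := by
        rw [quad]; ring
      rw [e, abs_mul, abs_of_nonneg (sq_nonneg (x (t + h) ω)), ← add_mul, ← mul_assoc]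
      refine mul_le_mul_of_nonneg_right ?_ (sq_nonneg _)
      rw [abs_mul, ← sq_abs (x t ω), ← sq_abs (x (t + h + h) ω)]
      nlinarith [sq_nonneg (|x t ω| - |x (t + h + h) ω|)]
  · have h1 := hx.integral_sq_sum_quad hh hk hhk L
    refine ⟨fun ω => v + |∑ t ∈ Finset.range L, quad x h k t ω| ^ 2 / v, ?_, ?_,
      fun ω => two_mul_le_add_sq_div hv⟩
    · simp only [sq_abs]
      exact (integrable_const v).add (h1.1.div_const v)
    · simp only [sq_abs]
      rw [integral_add (integrable_const v) (h1.1.div_const v), integral_div, h1.2]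
      simp [hhk]

/-- Differencing removes the linear phase, so Z does not depend on γ. Of the three terms N w², one
is the diagonal and two come from the single exceptional lag k + 1 = h. -/
lemma exists_bound_lag (hx : IsWhiteNoise μ w x) {h : ℕ} (hh : h ≠ 0) {L N : ℕ} (hL : L ≤ N)
    {v r : ℝ} (hv : 0 < v) (hr : 0 < r) : ∃ Z : Ω → ℝ, Integrable Z μ ∧
      ∫ ω, Z ω ∂μ ≤ r + (3 * (N * w ^ 2) + N * (v + N * w ^ 4 / v)) / r ∧
      ∀ ω, ∀ γ : ℝ, 2 * ‖∑ t ∈ Finset.range L, ((x t ω * x (t + h) ω : ℝ) : ℂ) * cis (γ * t)‖ ≤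
        Z ω := by
  have hw := hx.nonneg
  choose Z hZi hZ hZb using fun k : ℕ =>
    hx.exists_bound_quad hh (k := k + 1) (by omega) (L - (k + 1)) hv
  have h1 := fun t => hx.integrable_sq_mul_sq (s := t) (t := t + h) (by omega)
  have i1 : Integrable (fun ω => ∑ t ∈ Finset.range L, x t ω ^ 2 * x (t + h) ω ^ 2) μ :=
    integrable_finsetSum _ fun t _ => (h1 t).1
  have i2 : Integrable (fun ω => ∑ k ∈ Finset.range L, Z k ω) μ :=
    integrable_finsetSum _ fun k _ => hZi k
  have hLN : (L : ℝ) ≤ N := by exact_mod_cast hL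
  refine ⟨fun ω => r + (∑ t ∈ Finset.range L, x t ω ^ 2 * x (t + h) ω ^ 2 +
    ∑ k ∈ Finset.range L, Z k ω) / r, (integrable_const r).add ((i1.add i2).div_const r), ?_, ?_⟩
  · beta_reduce
    rw [integral_const_add_div i1 i2, integral_finsetSum _ fun t _ => (h1 t).1,
      integral_finsetSum _ fun k _ => hZi k, Finset.sum_congr rfl fun t _ => (h1 t).2]
    simp only [Finset.sum_const,
      Finset.card_range, nsmul_eq_mul]
    refine add_le_add le_rfl (div_le_div_of_nonneg_right ?_ hr.le)
    have h2 : ∑ k ∈ Finset.range L, ∫ ω, Z k ω ∂μ ≤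
        ∑ k ∈ Finset.range L, ((v + N * w ^ 4 / v) + if h = k + 1 then 2 * N * w ^ 2 else 0) := by
      refine Finset.sum_le_sum fun k _ => (hZ k).trans ?_
      have : ((L - (k + 1) : ℕ) : ℝ) ≤ N := by exact_mod_cast (Nat.sub_le _ _).trans hL
      split_ifs <;> gcongr
    have h3 : ∑ k ∈ Finset.range L, (if h = k + 1 then 2 * N * w ^ 2 else 0) ≤ 2 * N * w ^ 2 := by
      rw [← Finset.sum_filter]
      refine (Finset.sum_le_card_nsmul _ _ _ fun _ _ => le_rfl).trans ?_
      rw [nsmul_eq_mul]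
      refine mul_le_of_le_one_left (by positivity) ?_
      have : ((Finset.range L).filter fun k => h = k + 1).card ≤ 1 :=
        Finset.card_le_one.2 fun a ha b hb => by
          have := (Finset.mem_filter.1 ha).2
          have := (Finset.mem_filter.1 hb).2
          omega
      exact_mod_cast this
    rw [Finset.sum_add_distrib] at h2
    simp only [Finset.sum_const, Finset.card_range, nsmul_eq_mul] at h2
    have h4 : (L : ℝ) * (v + N * w ^ 4 / v) ≤ N * (v + N * w ^ 4 / v) := by gcongr
    have h5 : (L : ℝ) * w ^ 2 ≤ N * w ^ 2 := by gcongr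
    linarith
  · intro ω γ
    refine (two_mul_le_add_sq_div hr).trans ?_
    beta_reduce
    gcongr
    set y : ℕ → ℝ := fun t => x t ω * x (t + h) ω with hy
    have h2 := sq_norm_sum_le (fun t => (y t : ℂ) * cis (0 * (t : ℝ) ^ 2 + γ * t)) L
    have e : ∀ k ∈ Finset.range L, _ = _ :=
      fun k _ => norm_quadratic_lag y γ 0 (k + 1) (L - (k + 1))
    rw [Finset.sum_congr rfl e] at h2
    simp only [zero_mul, zero_add, mul_zero, cis_zero, mul_one, norm_mul, norm_cis] at h2
    refine h2.trans ?_
    rw [Finset.mul_sum]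
    refine add_le_add (le_of_eq ?_) (Finset.sum_le_sum fun k _ => le_trans (le_of_eq ?_) (hZb k ω))
    · refine Finset.sum_congr rfl fun t _ => ?_
      rw [Complex.norm_real, Real.norm_eq_abs, sq_abs, hy]; ring
    · rw [← Complex.ofReal_sum, Complex.norm_real, Real.norm_eq_abs]
      rfl

/-- A first differencing at lag h turns the quadratic phase into a linear one of frequency 2hβ, over
which the lag bound is uniform. -/
lemma exists_bound_sum (hx : IsWhiteNoise μ w x) (N : ℕ) {v r s : ℝ} (hv : 0 < v) (hr : 0 < r)
    (hs : 0 < s) : ∃ Z : Ω → ℝ, Integrable Z μ ∧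
      ∫ ω, Z ω ∂μ ≤
        s + (N * w + N * (r + (3 * (N * w ^ 2) + N * (v + N * w ^ 4 / v)) / r)) / s ∧
      ∀ ω, ∀ α β : ℝ,
        2 * ‖∑ t ∈ Finset.range N, (x t ω : ℂ) * cis (β * (t : ℝ) ^ 2 + α * t)‖ ≤ Z ω := by
  choose Z hZi hZ hZb using fun h : ℕ =>
    hx.exists_bound_lag (h := h + 1) (by omega) (Nat.sub_le N (h + 1)) hv hr
  have i1 : Integrable (fun ω => ∑ t ∈ Finset.range N, x t ω ^ 2) μ :=
    integrable_finsetSum _ fun t _ => (hx.memLp t).integrable_sq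
  have i2 : Integrable (fun ω => ∑ h ∈ Finset.range N, Z h ω) μ :=
    integrable_finsetSum _ fun h _ => hZi h
  refine ⟨fun ω => s + (∑ t ∈ Finset.range N, x t ω ^ 2 + ∑ h ∈ Finset.range N, Z h ω) / s,
    (integrable_const s).add ((i1.add i2).div_const s), ?_, ?_⟩
  · beta_reduce
    rw [integral_const_add_div i1 i2, integral_finsetSum _ fun t _ => (hx.memLp t).integrable_sq,
      integral_finsetSum _ fun h _ => hZi h, Finset.sum_congr rfl fun t _ => hx.sq_eq t]
    simp only [Finset.sum_const,
      Finset.card_range, nsmul_eq_mul]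
    gcongr
    exact (Finset.sum_le_card_nsmul _ _ _ fun h _ => hZ h).trans
      (by rw [Finset.card_range, nsmul_eq_mul])
  · intro ω α β
    refine (two_mul_le_add_sq_div hs).trans ?_
    beta_reduce
    gcongr
    have h2 := sq_norm_sum_le (fun t => (x t ω : ℂ) * cis (β * (t : ℝ) ^ 2 + α * t)) N
    have e : ∀ h ∈ Finset.range N, _ = _ :=
      fun h _ => norm_quadratic_lag (fun t => x t ω) α β (h + 1) (N - (h + 1))
    rw [Finset.sum_congr rfl e] at h2
    refine h2.trans ?_
    rw [Finset.mul_sum]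
    refine add_le_add (le_of_eq ?_) (Finset.sum_le_sum fun h _ => hZb h ω _)
    refine Finset.sum_congr rfl fun t _ => ?_
    rw [norm_mul, norm_cis, mul_one, Complex.norm_real, Real.norm_eq_abs, sq_abs]

end IsWhiteNoise

/-! ### Uniform strong law for the linear process -/

lemma add_one_pow_succ_le {m : ℝ} (hm : 0 ≤ m) (j : ℕ) :
    (m + 1) ^ (j + 1) ≤ m ^ (j + 1) + (j + 1) * (m + 1) ^ j := by
  induction j with
  | zero => simp
  | succ j ih =>
    have h1 : m ^ (j + 1) ≤ (m + 1) ^ (j + 1) := pow_le_pow_left₀ hm (by linarith) _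
    have h2 := mul_le_mul_of_nonneg_right ih (by linarith : 0 ≤ m + 1)
    push_cast
    calc (m + 1) ^ (j + 1 + 1) = (m + 1) ^ (j + 1) * (m + 1) := pow_succ _ _
      _ ≤ (m ^ (j + 1) + (j + 1) * (m + 1) ^ j) * (m + 1) := h2
      _ = m ^ (j + 1 + 1) + m ^ (j + 1) + (j + 1) * (m + 1) ^ (j + 1) := by ring
      _ ≤ _ := by linarith

lemma exists_pow_le_lt_add_one_pow {d : ℕ} (hd : d ≠ 0) (n : ℕ) :
    ∃ m : ℕ, m ^ d ≤ n ∧ n < (m + 1) ^ d := by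
  induction n with
  | zero => exact ⟨0, by simp [hd], by simp⟩
  | succ n ih =>
    obtain ⟨m, h1, h2⟩ := ih
    by_cases h : n + 1 < (m + 1) ^ d
    · exact ⟨m, by omega, h⟩
    · refine ⟨m + 1, by omega, ?_⟩
      have : (m + 1) ^ d < (m + 1 + 1) ^ d := Nat.pow_lt_pow_left (by omega) hd
      omega

section

variable {Ω : Type*} [MeasurableSpace Ω] {μ : Measure Ω} [IsProbabilityMeasure μ] {w : ℝ}

/-- A bound, uniform over phases and over sample sizes from `m ^ 16` to `(m + 1) ^ 16`, whose
expectation is summable in `m`. -/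
lemma IsWhiteNoise.exists_bound_block {x : ℕ → Ω → ℝ} (hx : IsWhiteNoise μ w x) {m : ℕ}
    (hm : 1 ≤ m) : ∃ Z : Ω → ℝ, Integrable Z μ ∧
      ∫ ω, Z ω ∂μ ≤ (3 + w + 3 * w ^ 2 + w ^ 4 + 2 ^ 19 * w) * (1 / (m * √m)) ∧ (∀ ω, 0 ≤ Z ω) ∧
      ∀ ω, ∀ n : ℕ, m ^ 16 ≤ n → n < (m + 1) ^ 16 → ∀ α β : ℝ,
        ‖∑ t ∈ Finset.range n, (x t ω : ℂ) * cis (β * (t : ℝ) ^ 2 + α * t)‖ ≤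
          (m : ℝ) ^ 16 * (Z ω + 2 ^ 19 / √m) := by
  have hw := hx.nonneg
  have hm1 : (1 : ℝ) ≤ m := by exact_mod_cast hm
  have hm0 : (0 : ℝ) < m := by linarith
  have hsq : 0 < √(m : ℝ) := Real.sqrt_pos.2 hm0
  have hsq2 : √(m : ℝ) * √m = m := Real.mul_self_sqrt hm0.le
  have hsqm : √(m : ℝ) ≤ m := by
    have : (1 : ℝ) ≤ √m := Real.one_le_sqrt.2 hm1
    nlinarith
  -- For N = m^16 the weights are N^(1/2), N^(3/4), N^(7/8). The expected supremum is O(m^14), which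
  -- relative to N is the summable m^(-2).
  obtain ⟨Z₁, hZi, hZ, hZb⟩ := hx.exists_bound_sum (m ^ 16) (v := (m : ℝ) ^ 8)
    (r := (m : ℝ) ^ 12) (s := (m : ℝ) ^ 14) (by positivity) (by positivity) (by positivity)
  have hZ0 : ∀ ω, 0 ≤ Z₁ ω := fun ω =>
    (mul_nonneg zero_le_two (norm_nonneg _)).trans (hZb ω 0 0)
  set T := Finset.Ico (m ^ 16) ((m + 1) ^ 16) with hT
  -- The constant is 16 · 2^15, from 16 (m + 1)^15 ≤ 16 (2m)^15.
  have hcard : (T.card : ℝ) ≤ 2 ^ 19 * (m : ℝ) ^ 15 := by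
    have h1 := add_one_pow_succ_le hm0.le 15
    have h2 : ((m : ℝ) + 1) ^ 15 ≤ (2 * m) ^ 15 := pow_le_pow_left₀ (by linarith) (by linarith) _
    rw [hT, Nat.card_Ico, Nat.cast_sub (Nat.pow_le_pow_left (by omega) _)]
    push_cast at h1 ⊢
    rw [mul_pow] at h2
    norm_num at h1 h2 ⊢
    linarith
  have i2 : Integrable (fun ω => ∑ t ∈ T, x t ω ^ 2) μ :=
    integrable_finsetSum _ fun t _ => (hx.memLp t).integrable_sq
  refine ⟨fun ω => Z₁ ω / (m : ℝ) ^ 16 + (∑ t ∈ T, x t ω ^ 2) / (√m * (m : ℝ) ^ 16),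
    (hZi.div_const _).add (i2.div_const _), ?_, fun ω => ?_, ?_⟩
  · rw [integral_add (hZi.div_const _) (i2.div_const _), integral_div, integral_div,
      integral_finsetSum _ fun t _ => (hx.memLp t).integrable_sq,
      Finset.sum_congr rfl fun t _ => hx.sq_eq t, add_mul]
    refine add_le_add ?_ ?_
    · have h1 : ∫ ω, Z₁ ω ∂μ ≤ (3 + w + 3 * w ^ 2 + w ^ 4) * (m : ℝ) ^ 14 := by
        refine hZ.trans ?_
        have e : (m : ℝ) ^ 14 + (((m ^ 16 : ℕ) : ℝ) * w + ((m ^ 16 : ℕ) : ℝ) * ((m : ℝ) ^ 12 +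
            (3 * (((m ^ 16 : ℕ) : ℝ) * w ^ 2) + ((m ^ 16 : ℕ) : ℝ) * ((m : ℝ) ^ 8 +
              ((m ^ 16 : ℕ) : ℝ) * w ^ 4 / (m : ℝ) ^ 8)) / (m : ℝ) ^ 12)) / (m : ℝ) ^ 14 =
            (3 + w ^ 4) * (m : ℝ) ^ 14 + w * (m : ℝ) ^ 2 + 3 * w ^ 2 * (m : ℝ) ^ 6 := by
          push_cast; field_simp; ring
        rw [e]
        have h2 : w * (m : ℝ) ^ 2 ≤ w * (m : ℝ) ^ 14 := by
          gcongr
          norm_num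
        have h3 : 3 * w ^ 2 * (m : ℝ) ^ 6 ≤ 3 * w ^ 2 * (m : ℝ) ^ 14 := by
          gcongr
          norm_num
        linarith
      calc (∫ ω, Z₁ ω ∂μ) / (m : ℝ) ^ 16
          ≤ (3 + w + 3 * w ^ 2 + w ^ 4) * (m : ℝ) ^ 14 / (m : ℝ) ^ 16 := by gcongr
        _ = (3 + w + 3 * w ^ 2 + w ^ 4) * (1 / (m * m)) := by field_simp
        _ ≤ _ := by gcongr
    · rw [Finset.sum_const, nsmul_eq_mul]
      calc T.card * w / (√m * (m : ℝ) ^ 16)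
          ≤ 2 ^ 19 * (m : ℝ) ^ 15 * w / (√m * (m : ℝ) ^ 16) := by gcongr
        _ = _ := by field_simp
  · have := hZ0 ω
    have : 0 ≤ ∑ t ∈ T, x t ω ^ 2 := Finset.sum_nonneg fun t _ => sq_nonneg _
    positivity
  · intro ω n hn1 hn2 α β
    set f : ℕ → ℂ := fun t => (x t ω : ℂ) * cis (β * (t : ℝ) ^ 2 + α * t) with hf
    have h1 : ∑ t ∈ Finset.range n, f t =
        ∑ t ∈ Finset.range (m ^ 16), f t + ∑ t ∈ Finset.Ico (m ^ 16) n, f t :=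
      (Finset.sum_range_add_sum_Ico f hn1).symm
    have h2 : ‖∑ t ∈ Finset.Ico (m ^ 16) n, f t‖ ≤ ∑ t ∈ T, |x t ω| := by
      refine (norm_sum_le _ _).trans ?_
      have e : ∀ t ∈ Finset.Ico (m ^ 16) n, ‖f t‖ = |x t ω| := fun t _ => by
        rw [hf, norm_mul, norm_cis, mul_one, Complex.norm_real, Real.norm_eq_abs]
      rw [Finset.sum_congr rfl e]
      exact Finset.sum_le_sum_of_subset_of_nonneg
        (Finset.Ico_subset_Ico_right hn2.le) fun t _ _ => abs_nonneg _
    -- Relative to m^16, splitting at √m leaves a deterministic part of order m^(-1/2) and a random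
    -- part of expectation O(m^(-3/2)), which is summable.
    have h3 : ∑ t ∈ T, |x t ω| ≤ 2 ^ 19 * (m : ℝ) ^ 15 * √m + (∑ t ∈ T, x t ω ^ 2) / √m := by
      calc ∑ t ∈ T, |x t ω| ≤ ∑ t ∈ T, (√m + x t ω ^ 2 / √m) := by
            refine Finset.sum_le_sum fun t _ => ?_
            have := IsWhiteNoise.two_mul_le_add_sq_div (V := |x t ω|) hsq
            rw [sq_abs] at this
            linarith [abs_nonneg (x t ω)]
        _ = T.card * √m + (∑ t ∈ T, x t ω ^ 2) / √m := by
            rw [Finset.sum_add_distrib, Finset.sum_const, nsmul_eq_mul, Finset.sum_div]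
        _ ≤ _ := by gcongr
    have h4 : ‖∑ t ∈ Finset.range (m ^ 16), f t‖ ≤ Z₁ ω := by
      have := hZb ω α β
      linarith [norm_nonneg (∑ t ∈ Finset.range (m ^ 16), f t)]
    have e : (m : ℝ) ^ 16 * (Z₁ ω / (m : ℝ) ^ 16 + (∑ t ∈ T, x t ω ^ 2) / (√m * (m : ℝ) ^ 16) +
        2 ^ 19 / √m) = Z₁ ω + ((∑ t ∈ T, x t ω ^ 2) / √m + 2 ^ 19 * (m : ℝ) ^ 15 * √m) := by
      have e1 : (m : ℝ) ^ 16 * (2 ^ 19 / √m) = 2 ^ 19 * (m : ℝ) ^ 15 * √m := by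
        rw [mul_div_assoc', div_eq_iff hsq.ne', mul_assoc _ (√(m : ℝ)), hsq2]; ring
      rw [mul_add, e1]
      field_simp
      ring
    rw [h1]
    beta_reduce
    rw [e]
    exact (norm_add_le _ _).trans (by linarith)

lemma enorm_sum_mul_le_tsum {a : ℤ → ℝ} {y : ℤ → ℕ → ℝ} {Y : ℕ → ℝ}
    (hY : ∀ t, HasSum (fun j => a j * y j t) (Y t)) (c : ℕ → ℂ) (n : ℕ) :
    ‖∑ t ∈ Finset.range n, (Y t : ℂ) * c t‖ₑ ≤
      ∑' j, ‖a j‖ₑ * ‖∑ t ∈ Finset.range n, (y j t : ℂ) * c t‖ₑ := by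
  have h1 : HasSum (fun j => ∑ t ∈ Finset.range n, ((a j * y j t : ℝ) : ℂ) * c t)
      (∑ t ∈ Finset.range n, (Y t : ℂ) * c t) :=
    hasSum_sum fun t _ => (Complex.hasSum_ofReal.2 (hY t)).mul_right (c t)
  rw [← h1.tsum_eq]
  refine enorm_tsum_le_tsum_enorm.trans (ENNReal.tsum_le_tsum fun j => le_of_eq ?_)
  have e : ∑ t ∈ Finset.range n, ((a j * y j t : ℝ) : ℂ) * c t =
      (a j : ℂ) * ∑ t ∈ Finset.range n, (y j t : ℂ) * c t := by
    rw [Finset.mul_sum]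
    refine Finset.sum_congr rfl fun t _ => ?_
    push_cast; ring
  rw [e, enorm_mul, ← ofReal_norm (a j : ℂ), ← ofReal_norm (a j), Complex.norm_real]

/-- A linear process is almost surely uncorrelated with all quadratic phases, uniformly. -/
lemma ae_eventually_norm_sum_le {a : ℤ → ℝ} (ha : Summable fun j => |a j|)
    {x : ℤ → ℕ → Ω → ℝ} (hx : ∀ j, IsWhiteNoise μ w (x j)) {Y : ℕ → Ω → ℝ}
    (hY : ∀ t, ∀ᵐ ω ∂μ, HasSum (fun j => a j * x j t ω) (Y t ω)) :
    ∀ᵐ ω ∂μ, ∀ ε > 0, ∀ᶠ n : ℕ in atTop, ∀ α β : ℝ,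
      ‖∑ t ∈ Finset.range n, (Y t ω : ℂ) * cis (β * (t : ℝ) ^ 2 + α * t)‖ ≤ ε * n := by
  have hw := (hx 0).nonneg
  choose Z hZi hZ hZ0 hZb using fun (j : ℤ) (m : ℕ) =>
    (hx j).exists_bound_block (m := m + 1) (by omega)
  set K : ℝ := 3 + w + 3 * w ^ 2 + w ^ 4 + 2 ^ 19 * w with hK
  have hK0 : 0 ≤ K := by positivity
  set A : ENNReal := ∑' j, ‖a j‖ₑ with hA
  have hAtop : A ≠ ⊤ := by
    have h1 : Summable fun j => ‖a j‖ := by simpa [Real.norm_eq_abs] using ha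
    have h2 : ∀ j, ‖a j‖ₑ = ENNReal.ofReal ‖a j‖ := fun j => (ofReal_norm (a j)).symm
    rw [hA]
    simp only [h2]
    exact h1.tsum_ofReal_ne_top
  -- All shifted noises share one bound on expectations, so absolute summability of a gives a single
  -- majorant, with no truncation of the process.
  set G : ℕ → Ω → ENNReal := fun m ω => ∑' j, ‖a j‖ₑ * ENNReal.ofReal (Z j m ω) with hG
  have hGm : ∀ j m, AEMeasurable (fun ω => ‖a j‖ₑ * ENNReal.ofReal (Z j m ω)) μ := fun j m =>
    ((hZi j m).aestronglyMeasurable.aemeasurable.ennreal_ofReal).const_mul _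
  have hGint : ∀ m, ∫⁻ ω, G m ω ∂μ ≤
      A * ENNReal.ofReal (K * (1 / (((m + 1 : ℕ) : ℝ) * √((m + 1 : ℕ) : ℝ)))) := by
    intro m
    rw [hG, lintegral_tsum fun j => hGm j m, hA, ← ENNReal.tsum_mul_right]
    refine ENNReal.tsum_le_tsum fun j => ?_
    rw [lintegral_const_mul' _ _ enorm_ne_top,
      ← ofReal_integral_eq_lintegral_ofReal (hZi j m) (Eventually.of_forall (hZ0 j m))]
    gcongr
    exact hZ j m
  have hsummable : Summable fun m : ℕ =>
      K * (1 / (((m + 1 : ℕ) : ℝ) * √((m + 1 : ℕ) : ℝ))) := by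
    have h1 := (summable_nat_add_iff 1).2
      (Real.summable_one_div_nat_rpow (p := 3 / 2) |>.2 (by norm_num))
    refine (h1.mul_left K).congr fun m => ?_
    have h2 : (0 : ℝ) < ((m + 1 : ℕ) : ℝ) := by positivity
    have e : (((m + 1 : ℕ) : ℝ)) ^ (3 / 2 : ℝ) = ((m + 1 : ℕ) : ℝ) * √((m + 1 : ℕ) : ℝ) := by
      rw [Real.sqrt_eq_rpow]
      nth_rewrite 2 [← Real.rpow_one ((m + 1 : ℕ) : ℝ)]
      rw [← Real.rpow_add h2]; norm_num
    rw [e]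
  -- A finite expected total makes the series converge almost surely, hence its terms tend to zero.
  have hGsum : ∫⁻ ω, ∑' m, G m ω ∂μ ≠ ⊤ := by
    rw [lintegral_tsum fun m => AEMeasurable.tsum fun j => hGm j m]
    refine ne_top_of_le_ne_top ?_ (ENNReal.tsum_le_tsum hGint)
    rw [ENNReal.tsum_mul_left]
    exact ENNReal.mul_ne_top hAtop hsummable.tsum_ofReal_ne_top
  have hGfin : ∀ᵐ ω ∂μ, ∑' m, G m ω < ⊤ :=
    ae_lt_top' (AEMeasurable.tsum fun m => AEMeasurable.tsum fun j => hGm j m) hGsum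
  filter_upwards [hGfin, ae_all_iff.2 hY] with ω hω hYω ε hε
  have hGlim : Tendsto (fun m => G m ω) atTop (𝓝 0) := by
    rw [← Nat.cofinite_eq_atTop]
    exact ENNReal.tendsto_cofinite_zero_of_tsum_ne_top hω.ne
  have hclim : Tendsto (fun m : ℕ => A * ENNReal.ofReal (2 ^ 19 / √((m + 1 : ℕ) : ℝ)))
      atTop (𝓝 0) := by
    have h1 : Tendsto (fun m : ℕ => 2 ^ 19 / √((m + 1 : ℕ) : ℝ)) atTop (𝓝 0) :=
      Tendsto.div_atTop tendsto_const_nhds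
        (Real.tendsto_sqrt_atTop.comp (tendsto_natCast_atTop_atTop.comp (tendsto_add_atTop_nat 1)))
    have h2 := ENNReal.tendsto_ofReal h1
    rw [ENNReal.ofReal_zero] at h2
    simpa using ENNReal.Tendsto.const_mul h2 (Or.inr hAtop)
  have hlim := hGlim.add hclim
  rw [add_zero] at hlim
  obtain ⟨m₀, hm₀⟩ := eventually_atTop.1
    (hlim.eventually (gt_mem_nhds (ENNReal.ofReal_pos.2 hε)))
  filter_upwards [eventually_ge_atTop ((m₀ + 1) ^ 16)] with n hn α β
  obtain ⟨k, hk1, hk2⟩ := exists_pow_le_lt_add_one_pow (d := 16) (by norm_num) n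
  have hmk : m₀ + 1 < k + 1 := lt_of_pow_lt_pow_left₀ 16 (by omega) (hn.trans_lt hk2)
  obtain ⟨m, rfl⟩ : ∃ m, k = m + 1 := ⟨k - 1, by omega⟩
  have hm := (hm₀ m (by omega)).le
  have hpow : (0 : ℝ) ≤ ((m + 1 : ℕ) : ℝ) ^ 16 := pow_nonneg (Nat.cast_nonneg _) _
  set c : ℕ → ℂ := fun t => cis (β * (t : ℝ) ^ 2 + α * t) with hc
  have hbound : ‖∑ t ∈ Finset.range n, (Y t ω : ℂ) * c t‖ₑ ≤
      ENNReal.ofReal (((m + 1 : ℕ) : ℝ) ^ 16) *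
        (G m ω + A * ENNReal.ofReal (2 ^ 19 / √((m + 1 : ℕ) : ℝ))) := by
    refine (enorm_sum_mul_le_tsum hYω c n).trans ?_
    rw [hG, hA, ← ENNReal.tsum_mul_right, ← ENNReal.tsum_add, ← ENNReal.tsum_mul_left]
    refine ENNReal.tsum_le_tsum fun j => ?_
    have h3 := hZb j m ω n hk1 hk2 α β
    have h4 : (0 : ℝ) ≤ 2 ^ 19 / √((m + 1 : ℕ) : ℝ) := by positivity
    generalize (2 : ℝ) ^ 19 / √((m + 1 : ℕ) : ℝ) = q at h3 h4 ⊢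
    generalize ((m + 1 : ℕ) : ℝ) ^ 16 = N at h3 hpow ⊢
    rw [← mul_add, ← ENNReal.ofReal_add (hZ0 j m ω) h4, mul_left_comm, ← ENNReal.ofReal_mul hpow,
      ← ofReal_norm (∑ t ∈ Finset.range n, _)]
    exact mul_le_mul' le_rfl (ENNReal.ofReal_le_ofReal h3)
  have h2 : ‖∑ t ∈ Finset.range n, (Y t ω : ℂ) * c t‖ₑ ≤
      ENNReal.ofReal (((m + 1 : ℕ) : ℝ) ^ 16 * ε) := by
    rw [ENNReal.ofReal_mul hpow]
    exact hbound.trans (by gcongr)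
  rw [← ofReal_norm, ENNReal.ofReal_le_ofReal_iff (mul_nonneg hpow hε.le)] at h2
  refine h2.trans ?_
  rw [mul_comm]
  have : (((m + 1 : ℕ) : ℝ)) ^ 16 ≤ n := by exact_mod_cast hk1
  exact mul_le_mul_of_nonneg_left this hε.le

end

/-! ### Sequential fits -/

/-- The `k`-th of `p` true components, or zero if there are fewer. -/
def target {p : ℕ} (ψ : ℕ → ℝ) (ϑ : Fin p → Component) (k : ℕ) : ℕ → ℝ :=
  if h : k < p then atom ψ (ϑ ⟨k, h⟩) else 0

lemma sum_filter_add_sum_target {p : ℕ} (ψ : ℕ → ℝ) (ϑ : Fin p → Component) (k : ℕ) :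
    ∑ j ∈ Finset.univ.filter (fun j : Fin p => k ≤ j), atom ψ (ϑ j) +
      ∑ i ∈ Finset.range k, target ψ ϑ i = ∑ j, atom ψ (ϑ j) := by
  induction k with
  | zero => simp
  | succ k ih =>
    rw [← ih, Finset.sum_range_succ, add_comm (∑ i ∈ Finset.range k, _), ← add_assoc]
    congr 1
    by_cases h : k < p
    · have e : Finset.univ.filter (fun j : Fin p => k ≤ j) =
          insert ⟨k, h⟩ (Finset.univ.filter fun j : Fin p => k + 1 ≤ j) := by
        ext j
        simp only [Finset.mem_filter, Finset.mem_univ, true_and, Finset.mem_insert, Fin.ext_iff]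
        omega
      rw [e, Finset.sum_insert (by simp), target, dif_pos h, add_comm]
    · have e : ∀ l, k ≤ l → Finset.univ.filter (fun j : Fin p => l ≤ j) = ∅ := by
        intro l hl
        ext j
        have := j.2
        simp
        omega
      rw [e k le_rfl, e (k + 1) (by omega), target, dif_neg h]
      simp

/-- Consistency of sequential least squares: each fit is asymptotically the true component of its
number, or zero. -/
lemma HasResonances.tendsto_sequential {ψ : ℕ → ℝ} {K : Submonoid ℕ} (hres : HasResonances ψ K)
    {M : ℝ} (hM : 0 < M) {p : ℕ} {ϑ : Fin p → Component} (hϑ : ∀ j, ϑ j ∈ paramSpace M)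
    (hsub : ∀ i j, i ≠ j → Nonresonant K (freq (ϑ i) - freq (ϑ j)))
    (hadd : ∀ i j, i ≠ j → Nonresonant K (freq (ϑ i) + freq (ϑ j)))
    (htwo : ∀ i, Nonresonant K (2 * freq (ϑ i)))
    (hanti : StrictAnti fun j => cosAmp (ϑ j) ^ 2 + sinAmp (ϑ j) ^ 2)
    (hpos : ∀ j, 0 < cosAmp (ϑ j) ^ 2 + sinAmp (ϑ j) ^ 2)
    {w : ℕ → ℕ → ℝ} (hw : UniformNull ψ M w) {P : ℕ} {est : ℕ → ℕ → Component}
    (hest : ∀ k < P, ∀ n, IsLSE M n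
      (∑ j, atom ψ (ϑ j) + w n - ∑ i ∈ Finset.range k, atom ψ (est n i)) (atom ψ) (est n k))
    {k : ℕ} (hk : k < P) :
    Tendsto (fun n => ip n (atom ψ (est n k) - target ψ ϑ k) (atom ψ (est n k) - target ψ ϑ k))
      atTop (𝓝 0) := by
  classical
  induction k using Nat.strong_induction_on with
  | _ k ih =>
  set J := Finset.univ.filter (fun j : Fin p => k ≤ j) with hJ
  -- The errors of the earlier fits have vanishing power by induction and are absorbed into the null
  -- array.
  have hv : UniformNull ψ M
      (w - ∑ i ∈ Finset.range k, fun n => atom ψ (est n i) - target ψ ϑ i) := by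
    refine hw.sub (UniformNull.sum _ fun i hi => UniformNull.of_ip_self ?_)
    have := Finset.mem_range.1 hi
    exact ih i this (this.trans hk)
  have hz : ∀ n, IsLSE M n (∑ j ∈ J, atom ψ (ϑ j) +
      (w - ∑ i ∈ Finset.range k, fun n => atom ψ (est n i) - target ψ ϑ i) n)
      (atom ψ) (est n k) := by
    intro n
    have e : ∑ j ∈ J, atom ψ (ϑ j) +
        (w - ∑ i ∈ Finset.range k, fun n => atom ψ (est n i) - target ψ ϑ i) n =
        ∑ j, atom ψ (ϑ j) + w n - ∑ i ∈ Finset.range k, atom ψ (est n i) := by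
      rw [Pi.sub_apply, Finset.sum_apply, Finset.sum_sub_distrib,
        ← sum_filter_add_sum_target ψ ϑ k]
      abel
    rw [e]
    exact hest k hk n
  by_cases h : k < p
  · rw [target, dif_pos h]
    refine tendsto_ip_sub_of_isLSE (J := J) (fun i _ => hϑ i)
      (L := fun j => (cosAmp (ϑ j) ^ 2 + sinAmp (ϑ j) ^ 2) / 2)
      (fun i _ => hres.tendsto_ip_self (htwo i)) (i₀ := ⟨k, h⟩) (by simp [hJ])
      (half_pos (hpos _)) (fun i hi hik => ?_) (fun ε hε => ?_) hv hz
    · have hki : (⟨k, h⟩ : Fin p) < i := lt_of_le_of_ne (Finset.mem_filter.1 hi).2 hik.symm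
      exact div_lt_div_of_pos_right (hanti hki) two_pos
    · have : ∀ᶠ n in atTop, ∀ i ∈ J, ∀ j ∈ J, i ≠ j → ∀ θ ∈ paramSpace M,
          |ip n (atom ψ (ϑ i)) (atom ψ θ)| < ε ∨ |ip n (atom ψ (ϑ j)) (atom ψ θ)| < ε := by
        refine (Filter.eventually_all_finset J).2 fun i _ =>
          (Filter.eventually_all_finset J).2 fun j _ => ?_
        by_cases hij : i = j
        · simp [hij]
        · filter_upwards [hres.exclusive hM (hϑ i) (hϑ j) (hsub i j hij) (hadd i j hij) hε]
            with n hn _ using hn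
      filter_upwards [this] with n hn θ hθ i hi j hj hij using hn i hi j hj hij θ hθ
  -- No true component is left: the residual is the null array alone.
  · have hJ0 : J = ∅ := by
      ext j
      have := j.2
      simp [hJ]
      omega
    rw [target, dif_neg h]
    simp only [sub_zero]
    simp only [hJ0, Finset.sum_empty, zero_add] at hz
    exact tendsto_ip_self_of_uniformNull hM.le hv hz

/-! ### The chirp-like model -/

lemma mem_of_mem_interior {M : ℝ} {θ : Component} (h : θ ∈ interior (paramSpace M)) :
    θ ∈ paramSpace M ∧ 0 < freq θ ∧ freq θ < Real.pi := by
  refine ⟨interior_subset h, ?_⟩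
  rw [paramSpace, interior_prod_eq, interior_prod_eq, interior_Icc, interior_Icc] at h
  exact h.2.2

/-- The offset 1 matches sums over `Finset.range n` with data observed from time 1. -/
lemma IsLinearProcess.isWhiteNoise {Ω : Type*} [MeasurableSpace Ω] {μ : Measure Ω} {σ : ℝ}
    {a : ℤ → ℝ} {e X : ℤ → Ω → ℝ} (hX : IsLinearProcess μ σ a e X) (j : ℤ) :
    IsWhiteNoise μ (σ ^ 2) fun (t : ℕ) => e ((t : ℤ) + 1 - j) where
  indep := hX.indep.precomp (g := fun t : ℕ => (t : ℤ) + 1 - j) fun s t h => by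
    have : (s : ℤ) + 1 - j = (t : ℤ) + 1 - j := h
    omega
  memLp t := hX.memLp _
  mean_eq t := hX.mean_eq _
  sq_eq t := by
    rw [← hX.variance_eq ((t : ℤ) + 1 - j), variance_of_integral_eq_zero
      (hX.memLp _).aestronglyMeasurable.aemeasurable (hX.mean_eq _)]

lemma IsLinearProcess.ae_uniformNull {Ω : Type*} [MeasurableSpace Ω] {μ : Measure Ω}
    [IsProbabilityMeasure μ] {σ : ℝ} {a : ℤ → ℝ} {e X : ℤ → Ω → ℝ}
    (hX : IsLinearProcess μ σ a e X) {M : ℝ} (hM : 0 < M) :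
    ∀ᵐ ω ∂μ, UniformNull (fun t => (t : ℝ)) M (fun _ t => X (t : ℤ) ω) ∧
      UniformNull (fun t => (t : ℝ) ^ 2) M (fun _ t => X (t : ℤ) ω) := by
  have h := ae_eventually_norm_sum_le hX.summable_coeff hX.isWhiteNoise
    (Y := fun t => X ((t : ℤ) + 1)) fun t => hX.hasSum _
  filter_upwards [h] with ω hω
  constructor
  · refine uniformNull_of_norm_sum_le hM fun ε hε => ?_
    filter_upwards [hω ε hε] with n hn γ
    have e := norm_sum_Icc_quadratic (fun t => X (t : ℤ) ω) γ 0 n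
    simp only [zero_mul, zero_add] at e
    rw [e]
    simpa using hn γ 0
  · refine uniformNull_of_norm_sum_le hM fun ε hε => ?_
    filter_upwards [hω ε hε] with n hn γ
    have e := norm_sum_Icc_quadratic (fun t => X (t : ℤ) ω) 0 γ n
    simp only [zero_mul, add_zero] at e
    rw [e]
    simpa using hn (2 * γ) γ

/-- At this stage the true chirps count as noise. Frequencies in (0, π) keep the relevant
differences, sums and doubles off the multiples of 2π. -/
lemma tendsto_sinusoid_fits {M : ℝ} (hM : 0 < M) {p q : ℕ} {θ : Fin p → Component}
    {ξ : Fin q → Component} (hθ : ∀ j, θ j ∈ interior (paramSpace M))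
    (hξ : ∀ k, ξ k ∈ interior (paramSpace M)) (hα : Function.Injective fun j => freq (θ j))
    (hAB : StrictAnti fun j => cosAmp (θ j) ^ 2 + sinAmp (θ j) ^ 2)
    (hAB0 : ∀ j, 0 < cosAmp (θ j) ^ 2 + sinAmp (θ j) ^ 2)
    (hirr : ∀ k, Irrational (freq (ξ k) / Real.pi)) {x : ℕ → ℝ}
    (hx : UniformNull (fun t => (t : ℝ)) M fun _ => x) {P Q : ℕ} {s c : ℕ → ℕ → Component}
    (hest : ∀ n, IsSequentialLSE M n (fun t => signal θ ξ t + x t) P Q (s n) (c n))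
    {k : ℕ} (hk : k < P) :
    Tendsto (fun n => ip n (atom (fun t => (t : ℝ)) (s n k) - target (fun t => (t : ℝ)) θ k)
      (atom (fun t => (t : ℝ)) (s n k) - target (fun t => (t : ℝ)) θ k)) atTop (𝓝 0) := by
  have hθ' := fun j => (mem_of_mem_interior (hθ j)).2
  have hpi := Real.pi_pos
  have hw : UniformNull (fun t => (t : ℝ)) M ((∑ k, fun _ => chirp (ξ k)) + fun _ => x) :=
    (UniformNull.sum _ fun k _ =>
      uniformNull_chirp hM (mem_of_mem_interior (hξ k)).1 (hirr k)).add hx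
  refine hasResonances_linear.tendsto_sequential hM (fun j => interior_subset (hθ j))
    (fun i j hij => ?_) (fun i j _ => ?_) (fun i => ?_) hAB hAB0 hw (P := P)
    (fun l hl n => ?_) hk
  · refine nonresonant_bot_of_abs_lt (sub_ne_zero.2 fun h => hij (hα h)) ?_
    rw [abs_lt]
    constructor <;> linarith [hθ' i, hθ' j]
  · refine nonresonant_bot_of_abs_lt (by linarith [hθ' i, hθ' j]) ?_
    rw [abs_lt]
    constructor <;> linarith [hθ' i, hθ' j]
  · refine nonresonant_bot_of_abs_lt (by linarith [hθ' i]) ?_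
    rw [abs_lt]
    constructor <;> linarith [hθ' i]
  · have h := (hest n).sinusoid_step l hl
    rw [sinusoid_eq_atom] at h
    have e : sinResidual (fun t => signal θ ξ t + x t) (s n) l =
        ∑ j, atom (fun t => (t : ℝ)) (θ j) + ((∑ k, fun _ => chirp (ξ k)) + fun _ => x : ℕ → ℕ → ℝ) n -
          ∑ i ∈ Finset.range l, atom (fun t => (t : ℝ)) (s n i) := by
      funext t
      simp only [sinResidual, signal, sinusoid_eq_atom, Pi.add_apply, Pi.sub_apply,
        Finset.sum_apply]
      ring
    rwa [e] at h

/-- Since p ≤ P, every true sinusoid has been matched, and surplus sinusoids have target zero. The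
errors left are null for chirps by their vanishing power alone. -/
lemma tendsto_chirp_fits {M : ℝ} (hM : 0 < M) {p q : ℕ} {θ : Fin p → Component}
    {ξ : Fin q → Component} (hξ : ∀ k, ξ k ∈ interior (paramSpace M))
    (hCD : StrictAnti fun k => cosAmp (ξ k) ^ 2 + sinAmp (ξ k) ^ 2)
    (hCD0 : ∀ k, 0 < cosAmp (ξ k) ^ 2 + sinAmp (ξ k) ^ 2)
    (hirr : ∀ k, Irrational (freq (ξ k) / Real.pi))
    (hirr₂ : ∀ k l, k ≠ l → Irrational ((freq (ξ k) - freq (ξ l)) / Real.pi) ∧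
      Irrational ((freq (ξ k) + freq (ξ l)) / Real.pi)) {x : ℕ → ℝ}
    (hx : UniformNull (fun t => (t : ℝ) ^ 2) M fun _ => x) {P Q : ℕ} {s c : ℕ → ℕ → Component}
    (hest : ∀ n, IsSequentialLSE M n (fun t => signal θ ξ t + x t) P Q (s n) (c n)) (hpP : p ≤ P)
    (hs : ∀ k < P, Tendsto (fun n =>
      ip n (atom (fun t => (t : ℝ)) (s n k) - target (fun t => (t : ℝ)) θ k)
        (atom (fun t => (t : ℝ)) (s n k) - target (fun t => (t : ℝ)) θ k)) atTop (𝓝 0))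
    {k : ℕ} (hk : k < Q) :
    Tendsto (fun n =>
      ip n (atom (fun t => (t : ℝ) ^ 2) (c n k) - target (fun t => (t : ℝ) ^ 2) ξ k)
        (atom (fun t => (t : ℝ) ^ 2) (c n k) - target (fun t => (t : ℝ) ^ 2) ξ k))
      atTop (𝓝 0) := by
  set v : ℕ → ℕ → ℕ → ℝ := fun i n =>
    atom (fun t => (t : ℝ)) (s n i) - target (fun t => (t : ℝ)) θ i with hv
  have hw : UniformNull (fun t => (t : ℝ) ^ 2) M ((fun _ => x) - ∑ i ∈ Finset.range P, v i) :=
    hx.sub (UniformNull.sum _ fun i hi => UniformNull.of_ip_self (hs i (Finset.mem_range.1 hi)))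
  have htarget : ∑ i ∈ Finset.range P, target (fun t => (t : ℝ)) θ i =
      ∑ j, atom (fun t => (t : ℝ)) (θ j) := by
    rw [← sum_filter_add_sum_target _ θ P,
      Finset.filter_false_of_mem fun j _ => not_le.2 (j.2.trans_le hpP), Finset.sum_empty, zero_add]
  refine hasResonances_square.tendsto_sequential hM (fun k => interior_subset (hξ k))
    (fun i j hij => nonresonant_of_irrational (hirr₂ i j hij).1)
    (fun i j hij => nonresonant_of_irrational (hirr₂ i j hij).2) (fun i => ?_) hCD hCD0 hw (P := Q)
    (fun l hl n => ?_) hk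
  · simpa using (nonresonant_of_irrational (hirr i)).natCast_mul two_ne_zero
  · have h := (hest n).chirp_step l hl
    rw [chirp_eq_atom] at h
    have e : chirpResidual (fun t => signal θ ξ t + x t) P (s n) (c n) l =
        ∑ j, atom (fun t => (t : ℝ) ^ 2) (ξ j) +
          ((fun _ => x) - ∑ i ∈ Finset.range P, v i : ℕ → ℕ → ℝ) n -
          ∑ i ∈ Finset.range l, atom (fun t => (t : ℝ) ^ 2) (c n i) := by
      rw [Pi.sub_apply, Finset.sum_apply, hv, Finset.sum_sub_distrib, htarget]
      funext t
      simp only [chirpResidual, sinResidual, signal, sinusoid_eq_atom, chirp_eq_atom, Pi.add_apply,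
        Pi.sub_apply, Finset.sum_apply]
      ring
    rwa [e] at h

end ChirpLike

end

theorem theorem9 {Ω : Type*} [MeasurableSpace Ω] (μ : Measure Ω) [IsProbabilityMeasure μ]
    -- the noise
    (σ : ℝ) (a : ℤ → ℝ) (e X : ℤ → Ω → ℝ) (hX : ChirpLike.IsLinearProcess μ σ a e X)
    -- the true components, interior points of the parameter space
    (M : ℝ) (hM : 0 < M) (p q : ℕ) (θ : Fin p → ChirpLike.Component) (ξ : Fin q → ChirpLike.Component)
    (hθ : ∀ j, θ j ∈ interior (ChirpLike.paramSpace M))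
    (hξ : ∀ k, ξ k ∈ interior (ChirpLike.paramSpace M))
    -- frequencies are distinct, and so are frequency rates
    (hα : Function.Injective fun j => ChirpLike.freq (θ j))
    (hβ : Function.Injective fun k => ChirpLike.freq (ξ k))
    -- strictly decreasing, positive powers
    (hAB : StrictAnti fun j => ChirpLike.cosAmp (θ j) ^ 2 + ChirpLike.sinAmp (θ j) ^ 2)
    (hAB0 : ∀ j, 0 < ChirpLike.cosAmp (θ j) ^ 2 + ChirpLike.sinAmp (θ j) ^ 2)
    (hCD : StrictAnti fun k => ChirpLike.cosAmp (ξ k) ^ 2 + ChirpLike.sinAmp (ξ k) ^ 2)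
    (hCD0 : ∀ k, 0 < ChirpLike.cosAmp (ξ k) ^ 2 + ChirpLike.sinAmp (ξ k) ^ 2)
    -- the frequency rates avoid the exceptional points, where chirp terms are not
    -- asymptotically orthogonal to sinusoids or to each other
    (hirr : ∀ k, Irrational (ChirpLike.freq (ξ k) / Real.pi))
    (hirr₂ : ∀ k l, k ≠ l →
      Irrational ((ChirpLike.freq (ξ k) - ChirpLike.freq (ξ l)) / Real.pi) ∧
      Irrational ((ChirpLike.freq (ξ k) + ChirpLike.freq (ξ l)) / Real.pi))
    -- sequential estimates of P sinusoids and Q chirp terms, for each sample size n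
    (P Q : ℕ) (s c : ℕ → Ω → ℕ → ChirpLike.Component)
    (hest : ∀ᵐ ω ∂μ, ∀ n, ChirpLike.IsSequentialLSE M n
      (fun t => ChirpLike.signal θ ξ t + X (t : ℤ) ω) P Q (s n ω) (c n ω)) :
    -- the extra sinusoid, which is number p + 1
    (p < P → ∀ᵐ ω ∂μ,
      Tendsto (fun n => ChirpLike.cosAmp (s n ω p)) atTop (𝓝 0) ∧
      ∀ r : ℝ, 0 < r →
        Tendsto (fun n => ChirpLike.sinAmp (s n ω p))
          (atTop ⊓ 𝓟 {n : ℕ | r / n ≤ ChirpLike.freq (s n ω p) ∧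
            ChirpLike.freq (s n ω p) ≤ Real.pi - r / n}) (𝓝 0)) ∧
    -- the extra chirp term, which is number q + 1
    (p ≤ P → q < Q → ∀ᵐ ω ∂μ,
      Tendsto (fun n => ChirpLike.cosAmp (c n ω q)) atTop (𝓝 0) ∧
      ∀ r : ℝ, 0 < r →
        Tendsto (fun n => ChirpLike.sinAmp (c n ω q))
          (atTop ⊓ 𝓟 {n : ℕ | r / (n : ℝ) ^ 2 ≤ ChirpLike.freq (c n ω q) ∧
            ChirpLike.freq (c n ω q) ≤ Real.pi - r / (n : ℝ) ^ 2}) (𝓝 0)) := by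
  have sinusoids : ∀ᵐ ω ∂μ, ∀ k < P, Tendsto (fun n => ChirpLike.ip n
      (ChirpLike.atom (fun t => (t : ℝ)) (s n ω k) - ChirpLike.target (fun t => (t : ℝ)) θ k)
      (ChirpLike.atom (fun t => (t : ℝ)) (s n ω k) - ChirpLike.target (fun t => (t : ℝ)) θ k))
      atTop (𝓝 0) := by
    filter_upwards [hest, hX.ae_uniformNull hM] with ω hω hnull k hk
    exact ChirpLike.tendsto_sinusoid_fits hM hθ hξ hα hAB hAB0 hirr hnull.1 hω hk
  constructor
  · intro hpP
    filter_upwards [hest, sinusoids] with ω hω hlim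
    have h0 := hlim p hpP
    -- Counted from zero, fit p is the first surplus one; its target is zero, so `h0` is about its
    -- own power.
    simp only [ChirpLike.target, lt_irrefl, dite_false, sub_zero] at h0
    simpa only [pow_one] using ChirpLike.endpointDegenerate_linear.tendsto_amp (fun t => by simp)
      (fun n => ((hω n).sinusoid_step p hpP).1) h0
  · intro hpP hqQ
    filter_upwards [hest, sinusoids, hX.ae_uniformNull hM] with ω hω hlim hnull
    have h0 := ChirpLike.tendsto_chirp_fits hM hξ hCD hCD0 hirr hirr₂ hnull.2 hω hpP hlim hqQ
    simp only [ChirpLike.target, lt_irrefl, dite_false, sub_zero] at h0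
    exact ChirpLike.endpointDegenerate_square.tendsto_amp (fun t => by simp)
      (fun n => ((hω n).chirp_step q hqQ).1) h0
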